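/- **Setting.** Let $n\ge 1$, let $\mathbf C\in\mathbb R_+^{n\times n}$ be a cost matrix with largest entry $\|\mathbf C\|_{\max}$, let $\mathbf r,\mathbf c\in\mathbb R_+^n$ be not both zero, and let $0\le s\le\min\{\|\mathbf r\|_1,\|\mathbf c\|_1\}$. Partial optimal transport (POT) minimises $\langle \mathbf C,\mathbf X\rangle$ over $$\mathcal U(\mathbf r,\mathbf c,s)=\{\mathbf X\in\mathbb R_+^{n\times n}:\ \mathbf X\mathbf 1\le\mathbf r,\ \mathbf X^\top\mathbf 1\le\mathbf c,\ \mathbf 1^\top\mathbf X\mathbf 1=s\}.$$ A matrix $\mathbf X$ is an $\varepsilon$-approximate solution if $\mathbf X\in\mathcal U(\mathbf r,\mathbf c,s)$ and $\langle \mathbf C,\mathbf X\rangle\le\langle \mathbf C,\mathbf X'\rangle+\varepsilon$ for all $\mathbf X'\in\mathcal U(\mathbf r,\mathbf c,s)$. **Feasible Sinkhorn with dummy cost $A>\|\mathbf C\|_{\max}$ and accuracy $\varepsilon$.** Put $\widetilde{\mathbf C}=\begin{pmatrix}\mathbf C&\mathbf 0\\ \mathbf 0^\top&A\end{pmatrix}$,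 $D=\|\mathbf r\|_1+\|\mathbf c\|_1-s$, $\mathbf a=(\mathbf r,\|\mathbf c\|_1-s)/D$, $\mathbf b=(\mathbf c,\|\mathbf r\|_1-s)/D$, $N=n+1$, $\gamma=\dfrac{\varepsilon/D}{4\log N}$ and $\delta=\min\{1,\dfrac{\varepsilon/D}{8\|\widetilde{\mathbf C}\|_{\max}}\}$. Replace $\mathbf a,\mathbf b$ by the smoothed marginals $(1-\frac\delta8)\mathbf a+\frac{\delta}{8N}\mathbf 1$ and $(1-\frac\delta8)\mathbf b+\frac{\delta}{8N}\mathbf 1$. Run Sinkhorn's iteration on $\mathbf B=\exp(\mathbf u\mathbf 1^\top+\mathbf 1\mathbf v^\top-\widetilde{\mathbf C}/\gamma)$ (entrywise exponential), starting at $\mathbf u=\mathbf v=\mathbf 0$ and rescaling alternately all rows and all columns to the smoothed marginals (rows first), until the $\ell_1$ errors of the row and column sums of $\mathbf B$ add up to at most $\delta/2$. Write $D\mathbf B=\begin{pmatrix}\mathbf X&\mathbf p\\ \mathbf q^\top&*\end{pmatrix}$ and output the matrix $\bar{\mathbf X}$ produced by Round-POT from $(\mathbf X,\mathbf p,\mathbf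 q)$ and $(\mathbf r,\mathbf c,s)$: 1. $\bar{\mathbf p}=\mathtt{EP}(\mathbf r,s,\mathbf p)$ and $\bar{\mathbf q}=\mathtt{EP}(\mathbf c,s,\mathbf q)$. Here $\mathtt{EP}(\mathbf r,s,\mathbf p)$ sets $\mathbf p'=\min\{\mathbf p,\mathbf r\}$; if $\|\mathbf p'\|_1>\|\mathbf r\|_1-s$ it returns $\frac{\|\mathbf r\|_1-s}{\|\mathbf p'\|_1}\mathbf p'$; otherwise, for $i=1,2,\dots$, as long as $\|\mathbf p'\|_1\le\|\mathbf r\|_1-s$ and $i\le n$, it replaces $p'_i$ by $r_i$, and finally it subtracts $\|\mathbf p'\|_1-(\|\mathbf r\|_1-s)$ from the last entry replaced and returns $\mathbf p'$. 2. $\mathbf g=\min\{\mathbf 1,(\mathbf r-\bar{\mathbf p})\oslash\mathbf X\mathbf 1\}$, $\mathbf h=\min\{\mathbf 1,(\mathbf c-\bar{\mathbf q})\oslash\mathbf X^\top\mathbf 1\}$, $\mathbf X'=\mathrm{diag}(\mathbf g)\,\mathbf X\,\mathrm{diag}(\mathbf h)$, where $\oslash$ is entrywise division. 3. $\mathbf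 e_1=\mathbf r-\bar{\mathbf p}-\mathbf X'\mathbf 1$, $\mathbf e_2=\mathbf c-\bar{\mathbf q}-\mathbf X'^\top\mathbf 1$, $\bar{\mathbf X}=\mathbf X'+\mathbf e_1\mathbf e_2^\top/\|\mathbf e_1\|_1$ (and $\bar{\mathbf X}=\mathbf X'$ if $\mathbf e_1=\mathbf 0$). Running time is the number of elementary operations on real numbers (arithmetic, $\exp$, $\log$, absolute values, comparisons) and of stored entries, each at unit cost. **Theorem (revised complexity of feasible Sinkhorn with Round-POT).** There is an absolute constant $K>0$ such that the following holds for all $n,\mathbf C,\mathbf r,\mathbf c,s$ as above and all $0<\varepsilon\le 1$. 1. For every dummy cost $A>\|\mathbf C\|_{\max}$ with $A\ge K\|\mathbf C\|_{\max}/\varepsilon$, feasible Sinkhorn terminates and its output is an $\varepsilon$-approximate solution of $\mathbf{POT}(\mathbf r,\mathbf c,s)$; in particular it is feasible. So a dummy cost $A=O(\|\mathbf C\|_{\max}/\varepsilon)$ suffices. 2. With $A=O(\|\mathbf C\|_{\max}/\varepsilon)$ the running time is $\widetilde O(n^2\|\mathbf C\|_{\max}^2/\varepsilon^4)$: for all $L,W$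 there is a constant $M$, depending only on $L$ and $W$, such that if moreover $\|\mathbf r\|_1,\|\mathbf c\|_1\le W$, $A\le L\|\mathbf C\|_{\max}/\varepsilon$ and $\varepsilon^2\le\|\mathbf C\|_{\max}$, then the procedure uses at most $$M\,\frac{n^2\|\mathbf C\|_{\max}^2}{\varepsilon^4}\,\log(n+1)$$ operations. -/

import Mathlib

open scoped BigOperators

noncomputable section

namespace POT

/-! The partial optimal transport problem. -/

/-- The feasible set `U(r, c, s)`: non-negative plans with row sums at most `r`, column sums
at most `c` and total transported mass exactly `s`. -/
def feasibleSet {n : ℕ} (r c : Fin n → ℝ) (s : ℝ) : Set (Matrix (Fin n) (Fin n) ℝ) :=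
  {X | (∀ i j, 0 ≤ X i j) ∧ (∀ i, ∑ j, X i j ≤ r i) ∧ (∀ j, ∑ i, X i j ≤ c j) ∧
    ∑ i, ∑ j, X i j = s}

/-- The transport cost `⟨C, X⟩`. -/
def cost {n : ℕ} (C X : Matrix (Fin n) (Fin n) ℝ) : ℝ := ∑ i, ∑ j, C i j * X i j

/-- `X` is an `ε`-approximate solution: it is feasible, and its cost exceeds that of no feasible
plan by more than `ε`. -/
def IsApproxSolution {n : ℕ} (C : Matrix (Fin n) (Fin n) ℝ) (r c : Fin n → ℝ) (s ε : ℝ)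
    (X : Matrix (Fin n) (Fin n) ℝ) : Prop :=
  X ∈ feasibleSet r c s ∧ ∀ Y ∈ feasibleSet r c s, cost C X ≤ cost C Y + ε

/-- The largest absolute value of an entry. -/
def maxNorm {ι κ : Type} (M : Matrix ι κ ℝ) : ℝ := ⨆ p : ι × κ, |M p.1 p.2|

/-! Computations over the reals with a count of the elementary operations. -/

/-- A value together with the number of elementary operations spent on computing it. -/
structure Timed (α : Type) where
  val : α
  ops : ℕ

instance : Monad Timed where
  pure a := ⟨a, 0⟩
  bind x f := ⟨(f x.val).val, x.ops + (f x.val).ops⟩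

/-! The elementary operations; each costs one unit. -/

def addOp (x y : ℝ) : Timed ℝ := ⟨x + y, 1⟩
def subOp (x y : ℝ) : Timed ℝ := ⟨x - y, 1⟩
def mulOp (x y : ℝ) : Timed ℝ := ⟨x * y, 1⟩
def divOp (x y : ℝ) : Timed ℝ := ⟨x / y, 1⟩
def minOp (x y : ℝ) : Timed ℝ := ⟨min x y, 1⟩
def expOp (x : ℝ) : Timed ℝ := ⟨Real.exp x, 1⟩
def logOp (x : ℝ) : Timed ℝ := ⟨Real.log x, 1⟩
def leOp (x y : ℝ) : Timed Bool := ⟨decide (x ≤ y), 1⟩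

/-- Compute a vector entry by entry; storing an entry costs one further unit. -/
def tabulate {ι : Type} [Fintype ι] (f : ι → Timed ℝ) : Timed (ι → ℝ) :=
  ⟨fun i => (f i).val, ∑ i, ((f i).ops + 1)⟩

/-- Compute a matrix entry by entry; storing an entry costs one further unit. -/
def tabulateMatrix {ι κ : Type} [Fintype ι] [Fintype κ] (f : ι → κ → Timed ℝ) :
    Timed (Matrix ι κ ℝ) :=
  ⟨Matrix.of fun i j => (f i j).val, ∑ i, ∑ j, ((f i j).ops + 1)⟩

/-- Sum the entries of a vector: one addition per entry. -/
def sumOp {ι : Type} [Fintype ι] (v : ι → ℝ) : Timed ℝ := ⟨∑ i, v i, Fintype.card ι⟩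

/-- The `ℓ₁` norm of a vector: an absolute value and an addition per entry. -/
def normOneOp {ι : Type} [Fintype ι] (v : ι → ℝ) : Timed ℝ :=
  ⟨∑ i, |v i|, 2 * Fintype.card ι⟩

/-- The maximum norm of a matrix: an absolute value and a comparison per entry. -/
def maxNormOp {ι κ : Type} [Fintype ι] [Fintype κ] (M : Matrix ι κ ℝ) : Timed ℝ :=
  ⟨maxNorm M, 2 * (Fintype.card ι * Fintype.card κ)⟩

/-! Sinkhorn's algorithm for balanced optimal transport. -/

section Sinkhorn

variable {ι : Type} [Fintype ι]

/-- Sinkhorn's iteration in the dual variables `u`, `v`, for the scaled cost `G = M / γ` and the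
target marginals `a`, `b`. The current plan is `B = exp (u 1ᵀ + 1 vᵀ - G)`. It is returned as soon
as `‖B 1 - a‖₁ + ‖Bᵀ 1 - b‖₁ ≤ tol`; otherwise its rows (if `rowTurn`) or its columns are rescaled
to the target marginal, and the roles of rows and columns alternate. The first argument is a cap on
the number of times the stopping test is made, with the value `none` if the cap is hit. -/
def sinkhornLoop (G : Matrix ι ι ℝ) (a b : ι → ℝ) (tol : ℝ) :
    ℕ → Bool → (ι → ℝ) → (ι → ℝ) → Timed (Option (Matrix ι ι ℝ))
  | 0, _, _, _ => pure none
  | cap + 1, rowTurn, u, v => do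
    let B ← tabulateMatrix fun i j => do
      let x ← addOp (u i) (v j)
      let y ← subOp x (G i j)
      expOp y
    let rows ← tabulate fun i => sumOp fun j => B i j
    let cols ← tabulate fun j => sumOp fun i => B i j
    let dRows ← tabulate fun i => subOp (rows i) (a i)
    let dCols ← tabulate fun j => subOp (cols j) (b j)
    let errRows ← normOneOp dRows
    let errCols ← normOneOp dCols
    let err ← addOp errRows errCols
    let done ← leOp err tol
    if done then
      pure (some B)
    else if rowTurn then do
      let u' ← tabulate fun i => do
        let x ← logOp (a i)
        let y ← logOp (rows i)
        let z ← subOp x y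
        addOp (u i) z
      sinkhornLoop G a b tol cap false u' v
    else do
      let v' ← tabulate fun j => do
        let x ← logOp (b j)
        let y ← logOp (cols j)
        let z ← subOp x y
        addOp (v j) z
      sinkhornLoop G a b tol cap true u v'

/-- The marginal `(1 - δ/8) a + δ/(8N) 1`, where `N` is the number of points. -/
def smooth (a : ι → ℝ) (δ : ℝ) : Timed (ι → ℝ) := do
  let t ← divOp δ 8
  let w ← subOp 1 t
  let m ← divOp t (Fintype.card ι)
  tabulate fun i => do
    let x ← mulOp w (a i)
    addOp x m

/-- Sinkhorn for the cost matrix `M`, probability marginals `a`, `b` and target accuracy `ε`, with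
the usual parameters `γ = ε / (4 log N)` and `δ = ε / (8 ‖M‖_max)` (capped at `1`): the marginals
are smoothed with parameter `δ`, and the iteration starts from `u = v = 0` and stops at marginal
error `δ / 2`. -/
def sinkhorn (M : Matrix ι ι ℝ) (a b : ι → ℝ) (ε : ℝ) (cap : ℕ) :
    Timed (Option (Matrix ι ι ℝ)) := do
  let l ← logOp (Fintype.card ι)
  let l4 ← mulOp 4 l
  let γ ← divOp ε l4
  let m ← maxNormOp M
  let m8 ← mulOp 8 m
  let δ₀ ← divOp ε m8
  let δ ← minOp 1 δ₀
  let a' ← smooth a δ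
  let b' ← smooth b δ
  let tol ← divOp δ 2
  let G ← tabulateMatrix fun i j => divOp (M i j) γ
  let u ← tabulate fun _ => pure 0
  let v ← tabulate fun _ => pure 0
  sinkhornLoop G a' b' tol cap true u v

end Sinkhorn

/-! The rounding procedure for partial optimal transport. -/

section Rounding

variable {n : ℕ}

/-- The loop of the enforcing procedure, over the indices in the given list: as long as the running
total `tot` of `p` is at most `target`, the next entry of `p` is replaced by the entry of `r`. The
last replaced index is recorded. -/
def enforceLoop (r : Fin n → ℝ) (target : ℝ) :
    List (Fin n) → (Fin n → ℝ) → ℝ → Option (Fin n) →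
      Timed ((Fin n → ℝ) × ℝ × Option (Fin n))
  | [], p, tot, last => pure (p, tot, last)
  | i :: is, p, tot, last => do
    let go ← leOp tot target
    if go then do
      let d ← subOp (r i) (p i)
      let tot' ← addOp tot d
      enforceLoop r target is (Function.update p i (r i)) tot' (some i)
    else
      pure (p, tot, last)

/-- The enforcing procedure: it turns a non-negative vector `p` into a vector `p̄` with
`0 ≤ p̄ ≤ r` and `‖p̄‖₁ = ‖r‖₁ - s`. -/
def enforce (r : Fin n → ℝ) (s : ℝ) (p : Fin n → ℝ) : Timed (Fin n → ℝ) := do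
  let R ← normOneOp r
  let target ← subOp R s
  let p' ← tabulate fun i => minOp (p i) (r i)
  let P ← normOneOp p'
  let small ← leOp P target
  if small then do
    let res ← enforceLoop r target (List.finRange n) p' P none
    match res.2.2 with
    | none => pure res.1
    | some i => do
      let excess ← subOp res.2.1 target
      let x ← subOp (res.1 i) excess
      pure (Function.update res.1 i x)
  else do
    let α ← divOp target P
    tabulate fun i => mulOp α (p' i)

/-- Round-POT: it turns non-negative `(X, p, q)` into `(X̄, p̄, q̄)` with `X̄ 1 + p̄ = r`,
`X̄ᵀ 1 + q̄ = c` and `1ᵀ X̄ 1 = s`. Only the plan `X̄` is returned. Where a row or column sum of `X`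
is zero, or `e₁ = 0`, the value of the quotient does not matter. -/
def roundPOT (X : Matrix (Fin n) (Fin n) ℝ) (p q r c : Fin n → ℝ) (s : ℝ) :
    Timed (Matrix (Fin n) (Fin n) ℝ) := do
  let pBar ← enforce r s p
  let qBar ← enforce c s q
  let r' ← tabulate fun i => subOp (r i) (pBar i)
  let c' ← tabulate fun j => subOp (c j) (qBar j)
  let rows ← tabulate fun i => sumOp fun j => X i j
  let cols ← tabulate fun j => sumOp fun i => X i j
  let g ← tabulate fun i => do
    let x ← divOp (r' i) (rows i)
    minOp 1 x
  let h ← tabulate fun j => do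
    let x ← divOp (c' j) (cols j)
    minOp 1 x
  let X' ← tabulateMatrix fun i j => do
    let x ← mulOp (g i) (X i j)
    mulOp x (h j)
  let rows' ← tabulate fun i => sumOp fun j => X' i j
  let cols' ← tabulate fun j => sumOp fun i => X' i j
  let e₁ ← tabulate fun i => subOp (r' i) (rows' i)
  let e₂ ← tabulate fun j => subOp (c' j) (cols' j)
  let E ← normOneOp e₁
  tabulateMatrix fun i j => do
    let x ← mulOp (e₁ i) (e₂ j)
    let y ← divOp x E
    addOp (X' i j) y

/-! The extended problem and the feasible Sinkhorn procedure. -/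

/-- The cost matrix with one dummy point on each side: cost `0` between a dummy and an original
point, cost `A` between the two dummies. -/
def extendedCost (C : Matrix (Fin n) (Fin n) ℝ) (A : ℝ) :
    Matrix (Fin n ⊕ Unit) (Fin n ⊕ Unit) ℝ :=
  Matrix.fromBlocks C 0 0 (Matrix.of fun _ _ => A)

/-- A marginal extended by the mass `t` of the dummy point. -/
def extendedMarginal (r : Fin n → ℝ) (t : ℝ) : Fin n ⊕ Unit → ℝ := Sum.elim r fun _ => t

/-- Feasible Sinkhorn for partial optimal transport with dummy cost `A`: run Sinkhorn on the
extended problem, with marginals `(r, ‖c‖₁ - s)` and `(c, ‖r‖₁ - s)` and accuracy `ε`, all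
divided by the total mass `D = ‖r‖₁ + ‖c‖₁ - s`; scale the plan back by `D`; cut it into the blocks
`X`, `p`, `q` (and the corner, which is dropped); apply Round-POT. The value is `none` if Sinkhorn
has not stopped within `cap` stopping tests. -/
def feasibleSinkhorn (C : Matrix (Fin n) (Fin n) ℝ) (r c : Fin n → ℝ) (s ε A : ℝ) (cap : ℕ) :
    Timed (Option (Matrix (Fin n) (Fin n) ℝ)) := do
  let R ← normOneOp r
  let S ← normOneOp c
  let tr ← subOp S s
  let tc ← subOp R s
  let D ← addOp R tr
  let M ← tabulateMatrix fun i j => pure (extendedCost C A i j)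
  let a ← tabulate fun i => divOp (extendedMarginal r tr i) D
  let b ← tabulate fun j => divOp (extendedMarginal c tc j) D
  let ε' ← divOp ε D
  let plan ← sinkhorn M a b ε' cap
  match plan with
  | none => pure none
  | some B => do
    let X ← tabulateMatrix fun i j => mulOp D (B (Sum.inl i) (Sum.inl j))
    let p ← tabulate fun i => mulOp D (B (Sum.inl i) (Sum.inr ()))
    let q ← tabulate fun j => mulOp D (B (Sum.inr ()) (Sum.inl j))
    let XBar ← roundPOT X p q r c s
    pure (some XBar)

end Rounding

end POT

end

/-! Correctness. Let `B` be the Gibbs plan at which Sinkhorn stops and let `m` bound the extended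
cost. Among plans with the same marginals a Gibbs plan is optimal up to an entropy term
(`gibbsPlan_cost_le`). A plan with slightly different marginals can be rounded to those of `B` at a
cost of `m` times the discrepancy (`roundPlan_spec`). With the chosen `γ` and `δ` this makes `B`
near-optimal for the extended problem (`sinkhorn_accuracy`).

A feasible partial plan extends to a balanced plan with corner `0`. Hence, after scaling by `D`, the
block `X` and the corner `w` of the Sinkhorn plan satisfy `⟨C, X⟩ + A w ≤ ⟨C, Y⟩ + 11/16 ε` for
every feasible `Y`. Round-POT adds at most `‖C‖ (w + 3η)`, with `η` the marginal error
(`roundPOT_spec`). The part `‖C‖ w` is paid for by the term `A w` already present on the left, so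
the corner never has to be bounded separately and `A ≥ 2‖C‖` is enough.

Running time. A row or column update lowers a convex dual objective by the relative entropy between
target and current marginal, which is at least a quarter of the squared error
(`sq_sum_abs_sub_le_kl`). Convexity and an a priori bound `ρ` on the oscillation of the dual
variables bound the gap between any two iterates after the first update by `2ρ` times the error. The
two facts together force the error below `tol` within `O(ρ / tol)` updates
(`exists_error_le_of_potential`). Here `ρ` is of order `A D log N / ε` and `1 / tol` of order `1 + A
D / ε`; each update costs `O(n²)`. Inserting `A ≤ L ‖C‖ / ε` gives the stated bound. -/

namespace POT

/-! Rounding a plan to prescribed marginals. -/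

section RoundPlan

variable {ι κ : Type} [Fintype ι] [Fintype κ]

/-- The plan `diag(g) X diag(h)`, whose row and column sums are at most `r` and `c`. -/
noncomputable def shrinkPlan (X : Matrix ι κ ℝ) (r : ι → ℝ) (c : κ → ℝ) : Matrix ι κ ℝ :=
  Matrix.of fun i j => min 1 (r i / ∑ j', X i j') * X i j * min 1 (c j / ∑ i', X i' j)

/-- The plan with marginals `r` and `c` obtained from `shrinkPlan` by a rank-one correction. -/
noncomputable def roundPlan (X : Matrix ι κ ℝ) (r : ι → ℝ) (c : κ → ℝ) : Matrix ι κ ℝ :=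
  Matrix.of fun i j => shrinkPlan X r c i j +
    (r i - ∑ j', shrinkPlan X r c i j') * (c j - ∑ i', shrinkPlan X r c i' j) /
      ∑ i', |r i' - ∑ j', shrinkPlan X r c i' j'|

theorem sum_sum_comm (X : Matrix ι κ ℝ) : ∑ i, ∑ j, X i j = ∑ j, ∑ i, X i j := Finset.sum_comm

/-- Scaling a row of sum `x` by this factor truncates the sum at `y`. For `x = 0` the junk value of
`y / 0` is harmless, being multiplied by zero. -/
theorem min_one_div_mul {x y : ℝ} (hx : 0 ≤ x) (hy : 0 ≤ y) : min 1 (y / x) * x = min x y := by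
  rcases hx.eq_or_lt with rfl | hx
  · simp [hy]
  · rw [min_mul_of_nonneg _ _ hx.le, one_mul, div_mul_cancel₀ _ hx.ne']

theorem shrinkPlan_nonneg {X : Matrix ι κ ℝ} {r : ι → ℝ} {c : κ → ℝ} (hX : ∀ i j, 0 ≤ X i j)
    (hr : ∀ i, 0 ≤ r i) (hc : ∀ j, 0 ≤ c j) (i : ι) (j : κ) : 0 ≤ shrinkPlan X r c i j := by
  have h1 : 0 ≤ ∑ j', X i j' := Finset.sum_nonneg fun j _ => hX i j
  have h2 : 0 ≤ ∑ i', X i' j := Finset.sum_nonneg fun i _ => hX i j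
  have h3 := div_nonneg (hr i) h1
  have h4 := div_nonneg (hc j) h2
  have := hX i j
  simp only [shrinkPlan, Matrix.of_apply]
  positivity

theorem shrinkPlan_transpose (X : Matrix ι κ ℝ) (r : ι → ℝ) (c : κ → ℝ) :
    shrinkPlan X.transpose c r = (shrinkPlan X r c).transpose := by
  ext i j
  simp only [shrinkPlan, Matrix.of_apply, Matrix.transpose_apply]
  ring

theorem shrinkPlan_le {X : Matrix ι κ ℝ} {r : ι → ℝ} {c : κ → ℝ} (hX : ∀ i j, 0 ≤ X i j)
    (hr : ∀ i, 0 ≤ r i) (i : ι) (j : κ) :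
    shrinkPlan X r c i j ≤ min 1 (r i / ∑ j', X i j') * X i j := by
  have h1 : 0 ≤ ∑ j', X i j' := Finset.sum_nonneg fun j _ => hX i j
  have h3 := div_nonneg (hr i) h1
  have := hX i j
  exact mul_le_of_le_one_right (by positivity) (min_le_left _ _)

theorem shrinkPlan_le_self {X : Matrix ι κ ℝ} {r : ι → ℝ} {c : κ → ℝ} (hX : ∀ i j, 0 ≤ X i j)
    (hr : ∀ i, 0 ≤ r i) (i : ι) (j : κ) : shrinkPlan X r c i j ≤ X i j :=
  (shrinkPlan_le hX hr i j).trans (mul_le_of_le_one_left (hX i j) (min_le_left _ _))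

theorem sum_shrinkPlan_row_le {X : Matrix ι κ ℝ} {r : ι → ℝ} {c : κ → ℝ} (hX : ∀ i j, 0 ≤ X i j)
    (hr : ∀ i, 0 ≤ r i) (i : ι) : ∑ j, shrinkPlan X r c i j ≤ r i := by
  refine (Finset.sum_le_sum fun j _ => shrinkPlan_le hX hr i j).trans ?_
  rw [← Finset.mul_sum, min_one_div_mul (Finset.sum_nonneg fun j _ => hX i j) (hr i)]
  exact min_le_right _ _

theorem sum_shrinkPlan_col_le {X : Matrix ι κ ℝ} {r : ι → ℝ} {c : κ → ℝ} (hX : ∀ i j, 0 ≤ X i j)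
    (hc : ∀ j, 0 ≤ c j) (j : κ) : ∑ i, shrinkPlan X r c i j ≤ c j := by
  have := sum_shrinkPlan_row_le (X := X.transpose) (c := r) (fun i j => hX j i) hc j
  simpa [shrinkPlan_transpose] using this

/-- For factors `g, h ≤ 1` one has `1 - g h ≤ (1 - g) + (1 - h)`; summed against `X`, the two terms
give exactly the row excesses and the column excesses. -/
theorem sub_shrinkPlan_le {X : Matrix ι κ ℝ} {r : ι → ℝ} {c : κ → ℝ} (hX : ∀ i j, 0 ≤ X i j)
    (hr : ∀ i, 0 ≤ r i) (hc : ∀ j, 0 ≤ c j) :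
    ∑ i, ∑ j, X i j - ∑ i, ∑ j, shrinkPlan X r c i j ≤
      ∑ i, max 0 (∑ j, X i j - r i) + ∑ j, max 0 (∑ i, X i j - c j) := by
  have hrow : ∀ i, 0 ≤ ∑ j', X i j' := fun i => Finset.sum_nonneg fun j _ => hX i j
  have hcol : ∀ j, 0 ≤ ∑ i', X i' j := fun j => Finset.sum_nonneg fun i _ => hX i j
  have key : ∀ i j, X i j - shrinkPlan X r c i j ≤
      (1 - min 1 (r i / ∑ j', X i j')) * X i j + (1 - min 1 (c j / ∑ i', X i' j)) * X i j := by
    intro i j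
    simp only [shrinkPlan, Matrix.of_apply]
    have h1 : 0 ≤ 1 - min 1 (r i / ∑ j', X i j') := sub_nonneg.2 (min_le_left _ _)
    have h2 : 0 ≤ 1 - min 1 (c j / ∑ i', X i' j) := sub_nonneg.2 (min_le_left _ _)
    have := mul_nonneg (mul_nonneg h1 h2) (hX i j)
    linarith
  have hmax : ∀ x y : ℝ, x - min x y = max 0 (x - y) := by
    intro x y
    rcases le_total x y with h | h
    · rw [min_eq_left h, max_eq_left (by linarith)]; ring
    · rw [min_eq_right h, max_eq_right (by linarith)]
  calc ∑ i, ∑ j, X i j - ∑ i, ∑ j, shrinkPlan X r c i j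
      = ∑ i, ∑ j, (X i j - shrinkPlan X r c i j) := by simp only [Finset.sum_sub_distrib]
    _ ≤ ∑ i, ∑ j, ((1 - min 1 (r i / ∑ j', X i j')) * X i j +
          (1 - min 1 (c j / ∑ i', X i' j)) * X i j) :=
        Finset.sum_le_sum fun i _ => Finset.sum_le_sum fun j _ => key i j
    _ = ∑ i, ∑ j, (1 - min 1 (r i / ∑ j', X i j')) * X i j +
          ∑ j, ∑ i, (1 - min 1 (c j / ∑ i', X i' j)) * X i j := by
        simp only [Finset.sum_add_distrib]
        rw [Finset.sum_comm (f := fun i j => (1 - min 1 (c j / ∑ i', X i' j)) * X i j)]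
    _ = _ := by
        congr 1
        · refine Finset.sum_congr rfl fun i _ => ?_
          rw [← Finset.mul_sum, sub_mul, one_mul, min_one_div_mul (hrow i) (hr i), hmax]
        · refine Finset.sum_congr rfl fun j _ => ?_
          rw [← Finset.mul_sum, sub_mul, one_mul, min_one_div_mul (hcol j) (hc j), hmax]

/-- `roundPlan` produces a plan with the prescribed marginals whose cost is controlled by the
excess of the marginals of the given plan. -/
theorem roundPlan_spec {X : Matrix ι κ ℝ} {r : ι → ℝ} {c : κ → ℝ} (hX : ∀ i j, 0 ≤ X i j)
    (hr : ∀ i, 0 ≤ r i) (hc : ∀ j, 0 ≤ c j) (hrc : ∑ i, r i = ∑ j, c j) :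
    (∀ i j, 0 ≤ roundPlan X r c i j) ∧ (∀ i, ∑ j, roundPlan X r c i j = r i) ∧
    (∀ j, ∑ i, roundPlan X r c i j = c j) ∧
    ∀ (M : Matrix ι κ ℝ) (m : ℝ), (∀ i j, 0 ≤ M i j) → (∀ i j, M i j ≤ m) → 0 ≤ m →
      ∑ i, ∑ j, M i j * roundPlan X r c i j ≤ ∑ i, ∑ j, M i j * X i j +
        m * (∑ i, r i - ∑ i, ∑ j, X i j + ∑ i, max 0 (∑ j, X i j - r i) +
          ∑ j, max 0 (∑ i, X i j - c j)) := by
  set S := shrinkPlan X r c with hS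
  have hS0 : ∀ i j, 0 ≤ S i j := shrinkPlan_nonneg hX hr hc
  set e : ι → ℝ := fun i => r i - ∑ j, S i j with he
  set f : κ → ℝ := fun j => c j - ∑ i, S i j with hf
  have he0 : ∀ i, 0 ≤ e i := fun i => sub_nonneg.2 (sum_shrinkPlan_row_le hX hr i)
  have hf0 : ∀ j, 0 ≤ f j := fun j => sub_nonneg.2 (sum_shrinkPlan_col_le hX hc j)
  set E := ∑ i, |e i| with hE
  have hEe : E = ∑ i, e i := Finset.sum_congr rfl fun i _ => abs_of_nonneg (he0 i)
  have hEr : E = ∑ i, r i - ∑ i, ∑ j, S i j := by rw [hEe]; simp [he]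
  have hEf : E = ∑ j, f j := by
    rw [hEr, hrc, sum_sum_comm]; simp [hf]
  have hE0 : 0 ≤ E := by rw [hEe]; exact Finset.sum_nonneg fun i _ => he0 i
  have hval : ∀ i j, roundPlan X r c i j = S i j + e i * f j / E := fun i j => rfl
  -- If no mass is missing, all residuals vanish, so the rank-one correction is zero whatever the
  -- quotient by `E = 0` means.
  have hdiv : ∀ x : ℝ, (E = 0 → x = 0) → x * E / E = x := by
    intro x hx
    by_cases h : E = 0
    · simp [h, hx h]
    · field_simp
  have hez : E = 0 → ∀ i, e i = 0 := fun h i =>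
    (Finset.sum_eq_zero_iff_of_nonneg fun i _ => he0 i).1 (hEe ▸ h) i (Finset.mem_univ i)
  have hfz : E = 0 → ∀ j, f j = 0 := fun h j =>
    (Finset.sum_eq_zero_iff_of_nonneg fun j _ => hf0 j).1 (hEf ▸ h) j (Finset.mem_univ j)
  refine ⟨fun i j => ?_, fun i => ?_, fun j => ?_, fun M m hM0 hMm hm => ?_⟩
  · rw [hval]
    have := hS0 i j
    have := he0 i
    have := hf0 j
    positivity
  · simp only [hval]
    rw [Finset.sum_add_distrib, ← Finset.sum_div, ← Finset.mul_sum, ← hEf,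
      hdiv _ fun h => hez h i]
    simp [he]
  · simp only [hval]
    rw [Finset.sum_add_distrib, ← Finset.sum_div, ← Finset.sum_mul, ← hEe, mul_comm,
      hdiv _ fun h => hfz h j]
    simp [hf]
  -- Shrinking cannot raise a nonnegative cost, and the correction carries mass `E`, hence costs at
  -- most `m * E`.
  · have h1 : ∀ i j, M i j * roundPlan X r c i j ≤ M i j * X i j + m * (e i * f j / E) := by
      intro i j
      rw [hval, mul_add]
      refine add_le_add (mul_le_mul_of_nonneg_left (shrinkPlan_le_self hX hr i j) (hM0 i j))
        (mul_le_mul_of_nonneg_right (hMm i j) ?_)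
      have := he0 i
      have := hf0 j
      positivity
    have h2 : ∑ i, ∑ j, m * (e i * f j / E) = m * E := by
      simp only [← Finset.mul_sum, ← Finset.sum_div]
      rw [← Finset.sum_mul, ← hEe, ← hEf, mul_self_div_self]
    calc ∑ i, ∑ j, M i j * roundPlan X r c i j
        ≤ ∑ i, ∑ j, (M i j * X i j + m * (e i * f j / E)) :=
          Finset.sum_le_sum fun i _ => Finset.sum_le_sum fun j _ => h1 i j
      _ = ∑ i, ∑ j, M i j * X i j + m * E := by simp only [Finset.sum_add_distrib, h2]
      _ ≤ _ := by
          have := sub_shrinkPlan_le hX hr hc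
          rw [hEr]
          gcongr
          linarith

end RoundPlan

/-! Gibbs kernels and the entropic optimality of scaled plans. -/

section Gibbs

variable {ι : Type}

/-- The plan `exp (u 1ᵀ + 1 vᵀ - G)`. -/
noncomputable def gibbsPlan (G : Matrix ι ι ℝ) (u v : ι → ℝ) : Matrix ι ι ℝ :=
  Matrix.of fun i j => Real.exp (u i + v j - G i j)

theorem gibbsPlan_pos (G : Matrix ι ι ℝ) (u v : ι → ℝ) (i j : ι) : 0 < gibbsPlan G u v i j :=
  Real.exp_pos _

theorem gibbsPlan_transpose (G : Matrix ι ι ℝ) (u v : ι → ℝ) :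
    gibbsPlan G.transpose v u = (gibbsPlan G u v).transpose := by
  ext i j
  simp [gibbsPlan, add_comm]

/-- Gibbs' inequality for a single pair of entries. -/
theorem sub_le_mul_log_sub {x y : ℝ} (hx : 0 ≤ x) (hy : 0 < y) :
    x - y ≤ x * Real.log x - x * Real.log y := by
  rcases hx.eq_or_lt with rfl | hx
  · simp [hy.le]
  · have := Real.log_le_sub_one_of_pos (div_pos hy hx)
    rw [Real.log_div hy.ne' hx.ne'] at this
    have h := mul_le_mul_of_nonneg_left this hx.le
    have e : x * (y / x - 1) = y - x := by field_simp
    linarith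

/-- Among the plans with its own marginals, a Gibbs plan is optimal up to an entropy term. -/
theorem gibbsPlan_cost_le [Fintype ι] [Nonempty ι] {G Y : Matrix ι ι ℝ} {u v : ι → ℝ}
    (hY : ∀ i j, 0 ≤ Y i j)
    (hrow : ∀ i, ∑ j, Y i j = ∑ j, gibbsPlan G u v i j)
    (hcol : ∀ j, ∑ i, Y i j = ∑ i, gibbsPlan G u v i j) :
    ∑ i, ∑ j, G i j * gibbsPlan G u v i j ≤ ∑ i, ∑ j, G i j * Y i j +
      2 * (∑ i, ∑ j, gibbsPlan G u v i j) * Real.log (Fintype.card ι) := by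
  set B := gibbsPlan G u v with hB
  have hB0 : ∀ i j, 0 < B i j := gibbsPlan_pos G u v
  have hlog : ∀ i j, Real.log (B i j) = u i + v j - G i j := fun i j => Real.log_exp _
  set t := ∑ i, ∑ j, B i j with ht
  have hYt : ∑ i, ∑ j, Y i j = t := Finset.sum_congr rfl fun i _ => hrow i
  have ht0 : 0 < t :=
    Finset.sum_pos (fun i _ => Finset.sum_pos (fun j _ => hB0 i j) Finset.univ_nonempty)
      Finset.univ_nonempty
  set N : ℝ := ((Fintype.card ι : ℕ) : ℝ) with hN
  have hN0 : 0 < N := Nat.cast_pos.2 Fintype.card_pos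
  -- Pairing with `log B` sees a plan only through its marginals and its cost. So for equal
  -- marginals the cost difference `⟨G, B⟩ - ⟨G, Y⟩` equals `∑ Y log B - ∑ B log B`.
  have expand : ∀ Z : Matrix ι ι ℝ, ∑ i, ∑ j, Z i j * Real.log (B i j) =
      ∑ i, u i * ∑ j, Z i j + ∑ j, v j * ∑ i, Z i j - ∑ i, ∑ j, G i j * Z i j := by
    intro Z
    simp only [Finset.mul_sum]
    rw [Finset.sum_comm (f := fun j i => v j * Z i j)]
    simp only [← Finset.sum_add_distrib, ← Finset.sum_sub_distrib]
    refine Finset.sum_congr rfl fun i _ => Finset.sum_congr rfl fun j _ => ?_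
    rw [hlog]; ring
  have eY := expand Y
  have eB := expand B
  simp only [hrow, hcol] at eY
  have k1 : 0 ≤ ∑ i, ∑ j, Y i j * Real.log (Y i j) - ∑ i, ∑ j, Y i j * Real.log (B i j) := by
    have : ∑ i, ∑ j, (Y i j - B i j) ≤
        ∑ i, ∑ j, (Y i j * Real.log (Y i j) - Y i j * Real.log (B i j)) :=
      Finset.sum_le_sum fun i _ => Finset.sum_le_sum fun j _ =>
        sub_le_mul_log_sub (hY i j) (hB0 i j)
    simp only [Finset.sum_sub_distrib, hYt] at this
    linarith
  have k2 : ∑ i, ∑ j, Y i j * Real.log (Y i j) ≤ t * Real.log t := by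
    rw [← hYt, Finset.sum_mul]
    refine Finset.sum_le_sum fun i _ => ?_
    rw [Finset.sum_mul]
    refine Finset.sum_le_sum fun j _ => ?_
    rcases (hY i j).eq_or_lt with h | h
    · simp [← h]
    · refine mul_le_mul_of_nonneg_left (Real.log_le_log h ?_) h.le
      exact (Finset.single_le_sum (fun j _ => hY i j) (Finset.mem_univ j)).trans
        (Finset.single_le_sum (f := fun i => ∑ j, Y i j)
          (fun i _ => Finset.sum_nonneg fun j _ => hY i j) (Finset.mem_univ i))
  -- Gibbs' inequality against the uniform plan of mass `t`, whose entries are `t / N ^ 2`.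
  have k3 : t * Real.log t - 2 * t * Real.log N ≤ ∑ i, ∑ j, B i j * Real.log (B i j) := by
    have h1 : ∑ i, ∑ j, (B i j - t / N ^ 2) ≤
        ∑ i, ∑ j, (B i j * Real.log (B i j) - B i j * Real.log (t / N ^ 2)) :=
      Finset.sum_le_sum fun i _ => Finset.sum_le_sum fun j _ =>
        sub_le_mul_log_sub (hB0 i j).le (by positivity)
    simp only [Finset.sum_sub_distrib, ← Finset.sum_mul, Finset.sum_const, Finset.card_univ,
      nsmul_eq_mul] at h1
    rw [← ht, ← hN, Real.log_div ht0.ne' (by positivity), Real.log_pow] at h1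
    have : N * (N * (t / N ^ 2)) = t := by field_simp
    push_cast at h1
    linarith
  linarith

end Gibbs

/-! Convergence of Sinkhorn's iteration. -/

section Convergence

/-- A lower bound for the Kullback–Leibler divergence of two positive probability vectors. -/
theorem sq_sum_abs_sub_le_kl {ι : Type} [Fintype ι] {a p : ι → ℝ} (ha : ∀ i, 0 < a i)
    (hp : ∀ i, 0 < p i) (ha1 : ∑ i, a i = 1) (hp1 : ∑ i, p i = 1) :
    (∑ i, |p i - a i|) ^ 2 / 4 ≤ ∑ i, a i * (Real.log (a i) - Real.log (p i)) := by
  -- With `x = √a` and `y = √p`, the inequality `x log (x / y) ≥ x - y` times `2x` gives `2x² - 2xy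
  -- = x² - y² + (x - y)²`. The relative entropy thus dominates the squared Hellinger distance,
  -- which Cauchy–Schwarz then compares with the `ℓ₁` distance.
  have h1 : ∀ i, a i - p i + (√(a i) - √(p i)) ^ 2 ≤ a i * (Real.log (a i) - Real.log (p i)) := by
    intro i
    have hx := Real.sqrt_pos.2 (ha i)
    have hy := Real.sqrt_pos.2 (hp i)
    have hxx := Real.sq_sqrt (ha i).le
    have hyy := Real.sq_sqrt (hp i).le
    generalize √(a i) = x at *
    generalize √(p i) = y at *
    rw [← hxx, ← hyy, Real.log_pow, Real.log_pow]
    have h := sub_le_mul_log_sub hx.le hy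
    push_cast
    nlinarith [mul_le_mul_of_nonneg_left h hx.le]
  have h2 : ∑ i, (√(a i) - √(p i)) ^ 2 ≤ ∑ i, a i * (Real.log (a i) - Real.log (p i)) := by
    have := Finset.sum_le_sum fun i (_ : i ∈ Finset.univ) => h1 i
    rw [Finset.sum_add_distrib, Finset.sum_sub_distrib, ha1, hp1] at this
    linarith
  have h3 : ∑ i, (√(a i) + √(p i)) ^ 2 ≤ 4 := by
    calc ∑ i, (√(a i) + √(p i)) ^ 2 ≤ ∑ i, 2 * (a i + p i) := by
          refine Finset.sum_le_sum fun i _ => ?_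
          nlinarith [Real.sq_sqrt (ha i).le, Real.sq_sqrt (hp i).le, sq_nonneg (√(a i) - √(p i))]
      _ = 4 := by rw [← Finset.mul_sum, Finset.sum_add_distrib, ha1, hp1]; norm_num
  have h4 : (∑ i, |p i - a i|) ^ 2 ≤
      (∑ i, (√(a i) - √(p i)) ^ 2) * ∑ i, (√(a i) + √(p i)) ^ 2 := by
    have e : ∀ i, |p i - a i| = |√(a i) - √(p i)| * (√(a i) + √(p i)) := by
      intro i
      rw [← abs_of_nonneg (add_nonneg (Real.sqrt_nonneg (a i)) (Real.sqrt_nonneg (p i))),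
        ← abs_mul, abs_sub_comm]
      congr 1
      nlinarith [Real.sq_sqrt (ha i).le, Real.sq_sqrt (hp i).le]
    have := Finset.sum_mul_sq_le_sq_mul_sq Finset.univ (fun i => |√(a i) - √(p i)|)
      (fun i => √(a i) + √(p i))
    simp only [sq_abs] at this
    simpa only [e] using this
  have h5 : 0 ≤ ∑ i, (√(a i) - √(p i)) ^ 2 := Finset.sum_nonneg fun i _ => sq_nonneg _
  nlinarith

/-- A potential whose decrease per step is quadratic in an error that dominates the potential
cannot keep the error above `tol` for more than `O(ρ / tol)` steps. -/
theorem exists_error_le_of_potential {Δ e : ℕ → ℝ} {ρ tol : ℝ} {h : ℕ} (hρ : 0 < ρ)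
    (htol : 0 < tol) (hdec : ∀ k, Δ (k + 1) ≤ Δ k - e k ^ 2 / 4)
    (hgap : ∀ k ≤ 2 * h, Δ k - Δ (2 * h) ≤ ρ * e k) (hh : 4 * ρ < h * tol) :
    ∃ k < 2 * h, e k ≤ tol := by
  by_contra! hcon
  have hanti : Antitone Δ := antitone_nat_of_succ_le fun k => by nlinarith [hdec k, sq_nonneg (e k)]
  -- Normalised so that the recursion becomes `x (k + 1) ≤ x k - x k ^ 2`, whose solutions decay
  -- like `1 / k`. The gap is measured from the iterate `2 * h`, so no minimiser of the potential is
  -- needed.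
  set x : ℕ → ℝ := fun k => (Δ k - Δ (2 * h)) / (4 * ρ ^ 2) with hx
  have hx0 : ∀ k ≤ 2 * h, 0 ≤ x k := fun k hk =>
    div_nonneg (sub_nonneg.2 (hanti hk)) (by positivity)
  have hxx : ∀ k, Δ k - Δ (2 * h) = 4 * ρ ^ 2 * x k := fun k => by
    simp only [hx]; field_simp
  have hstep : ∀ k < 2 * h, x (k + 1) ≤ x k - x k ^ 2 := by
    intro k hk
    have h1 := hgap k hk.le
    have h2 := hx0 k hk.le
    have h3 := hdec k
    have h4 := hxx k
    have h5 := hxx (k + 1)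
    have h6 : 4 * ρ * x k ≤ e k := by
      refine le_of_mul_le_mul_left ?_ hρ
      nlinarith
    have h7 : (4 * ρ * x k) ^ 2 ≤ e k ^ 2 := pow_le_pow_left₀ (by positivity) h6 2
    have h8 : 0 < 4 * ρ ^ 2 := by positivity
    refine le_of_mul_le_mul_left ?_ h8
    nlinarith
  have hrec : ∀ k ≤ 2 * h, k * x k ≤ 1 := by
    intro k
    induction k with
    | zero => simp
    | succ k ih =>
      intro hk
      have h1 := ih (by omega)
      have h2 := hstep k (by omega)
      have h3 := hx0 (k + 1) hk
      have h4 := hx0 k (by omega)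
      have h5 : x k ≤ 1 := by nlinarith
      push_cast
      calc ((k : ℝ) + 1) * x (k + 1) ≤ (k + 1) * (x k - x k ^ 2) := by gcongr
        _ = (k * x k) * (1 - x k) + (x k - x k ^ 2) := by ring
        _ ≤ 1 * (1 - x k) + (x k - x k ^ 2) := by
          have : 0 ≤ 1 - x k := by linarith
          gcongr
        _ ≤ 1 := by nlinarith [sq_nonneg (x k)]
  -- Second phase: from step `h` on, each step still gains `tol ^ 2 / 4` as long as the error
  -- exceeds `tol`. The gap left at step `h` is at most `4 * ρ ^ 2 / h`, which forces `h * tol ≤ 4 *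
  -- ρ`.
  have hlin : ∀ m ≤ h, m * (tol ^ 2 / 4) ≤ Δ h - Δ (h + m) := by
    intro m
    induction m with
    | zero => simp
    | succ m ih =>
      intro hm
      have h1 := ih (by omega)
      have h2 := hdec (h + m)
      have h3 := hcon (h + m) (by omega)
      have h4 : tol ^ 2 ≤ e (h + m) ^ 2 := pow_le_pow_left₀ htol.le h3.le 2
      push_cast
      rw [← add_assoc]
      linarith
  have h1 := hlin h le_rfl
  have h2 := hrec h (by omega)
  rw [← two_mul, hxx] at h1
  have h0 : (0 : ℝ) ≤ h := by positivity
  have h3 : (h : ℝ) * (h * (tol ^ 2 / 4)) ≤ h * (4 * ρ ^ 2 * x h) :=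
    mul_le_mul_of_nonneg_left h1 h0
  have h4 : (4 * ρ) ^ 2 < (h * tol) ^ 2 := pow_lt_pow_left₀ hh (by positivity) two_ne_zero
  nlinarith [sq_nonneg ρ]

/-- A zero-sum vector pairs with a vector of small oscillation to a small number. -/
theorem sum_mul_le_of_osc {ι : Type} [Fintype ι] {x d : ι → ℝ} {ρ : ℝ}
    (hx : ∀ i k, x i - x k ≤ ρ) (hd : ∑ i, d i = 0) : ∑ i, x i * d i ≤ ρ * ∑ i, |d i| := by
  rcases isEmpty_or_nonempty ι with h | ⟨⟨k⟩⟩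
  · simp
  have : ∑ i, x i * d i = ∑ i, (x i - x k) * d i := by
    simp only [sub_mul, Finset.sum_sub_distrib, ← Finset.mul_sum, hd, mul_zero, sub_zero]
  rw [this, Finset.mul_sum]
  refine Finset.sum_le_sum fun i _ => ?_
  refine (le_abs_self _).trans ?_
  rw [abs_mul]
  refine mul_le_mul_of_nonneg_right (abs_le.2 ⟨?_, hx i k⟩) (abs_nonneg _)
  linarith [hx k i]

variable {ι : Type} [Fintype ι]

/-- The sum of the `ℓ₁` errors of the row and the column sums of a plan. -/
noncomputable def marginalError (B : Matrix ι ι ℝ) (a b : ι → ℝ) : ℝ :=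
  ∑ i, |∑ j, B i j - a i| + ∑ j, |∑ i, B i j - b j|

/-- The dual objective that Sinkhorn's iteration decreases. -/
noncomputable def dualObjective (G : Matrix ι ι ℝ) (a b u v : ι → ℝ) : ℝ :=
  ∑ i, ∑ j, gibbsPlan G u v i j - ∑ i, u i * a i - ∑ j, v j * b j

/-- The dual variable that rescales the rows to the marginal `a`. -/
noncomputable def rowUpdate (G : Matrix ι ι ℝ) (a u v : ι → ℝ) : ι → ℝ :=
  fun i => u i + (Real.log (a i) - Real.log (∑ j, gibbsPlan G u v i j))

/-- One step of Sinkhorn's iteration; the Boolean tells whether the rows are rescaled. -/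
noncomputable def sinkhornStep (G : Matrix ι ι ℝ) (a b : ι → ℝ)
    (st : Bool × (ι → ℝ) × (ι → ℝ)) : Bool × (ι → ℝ) × (ι → ℝ) :=
  if st.1 then (false, rowUpdate G a st.2.1 st.2.2, st.2.2)
  else (true, st.2.1, rowUpdate G.transpose b st.2.2 st.2.1)

theorem marginalError_transpose (B : Matrix ι ι ℝ) (a b : ι → ℝ) :
    marginalError B.transpose b a = marginalError B a b := add_comm _ _

theorem dualObjective_transpose (G : Matrix ι ι ℝ) (a b u v : ι → ℝ) :
    dualObjective G.transpose b a v u = dualObjective G a b u v := by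
  simp only [dualObjective, gibbsPlan_transpose, Matrix.transpose_apply]
  rw [Finset.sum_comm]; ring

theorem sum_gibbsPlan_pos [Nonempty ι] (G : Matrix ι ι ℝ) (u v : ι → ℝ) (i : ι) :
    0 < ∑ j, gibbsPlan G u v i j :=
  Finset.sum_pos (fun j _ => gibbsPlan_pos G u v i j) Finset.univ_nonempty

theorem sum_gibbsPlan_rowUpdate [Nonempty ι] (G : Matrix ι ι ℝ) {a : ι → ℝ} (u v : ι → ℝ)
    (ha : ∀ i, 0 < a i) (i : ι) : ∑ j, gibbsPlan G (rowUpdate G a u v) v i j = a i := by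
  have hpos := sum_gibbsPlan_pos G u v i
  have : ∀ j, gibbsPlan G (rowUpdate G a u v) v i j =
      a i / (∑ j, gibbsPlan G u v i j) * gibbsPlan G u v i j := by
    intro j
    rw [← Real.exp_log (div_pos (ha i) hpos), Real.log_div (ha i).ne' hpos.ne']
    show Real.exp (u i + (Real.log (a i) - Real.log (∑ j, gibbsPlan G u v i j)) + v j - G i j) =
      Real.exp _ * Real.exp (u i + v j - G i j)
    rw [← Real.exp_add]
    ring_nf
  rw [Finset.sum_congr rfl fun j _ => this j, ← Finset.mul_sum, div_mul_cancel₀ _ hpos.ne']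

/-- The dual variable of matched rows has oscillation at most `g - log α`. -/
theorem osc_le_of_rows_eq {G : Matrix ι ι ℝ} {a u v : ι → ℝ} {g α : ℝ}
    (hG0 : ∀ i j, 0 ≤ G i j) (hGg : ∀ i j, G i j ≤ g) (hα : 0 < α) (haα : ∀ i, α ≤ a i)
    (ha1 : ∀ i, a i ≤ 1) (hrow : ∀ i, ∑ j, gibbsPlan G u v i j = a i) (i k : ι) :
    u i - u k ≤ g - Real.log α := by
  have h1 : α ≤ Real.exp (u k - u i + g) := by
    -- Since `G` takes values in `[0, g]`, each entry of row `k` is at most `exp (u k - u i + g)`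
    -- times the entry of row `i` in the same column.
    calc α ≤ ∑ j, gibbsPlan G u v k j := (hrow k).symm ▸ haα k
      _ ≤ ∑ j, Real.exp (u k - u i + g) * gibbsPlan G u v i j := by
          refine Finset.sum_le_sum fun j _ => ?_
          simp only [gibbsPlan, Matrix.of_apply, ← Real.exp_add]
          refine Real.exp_le_exp.2 ?_
          linarith [hG0 k j, hGg i j]
      _ = Real.exp (u k - u i + g) * a i := by rw [← Finset.mul_sum, hrow]
      _ ≤ Real.exp (u k - u i + g) := mul_le_of_le_one_right (Real.exp_pos _).le (ha1 i)
  have h2 := (Real.log_le_iff_le_exp hα).2 h1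
  linarith

/-- The property shared by the iterates of Sinkhorn's iteration after the first step. -/
structure IsBalanced (G : Matrix ι ι ℝ) (a b : ι → ℝ) (ρ : ℝ)
    (st : Bool × (ι → ℝ) × (ι → ℝ)) : Prop where
  mass : ∑ i, ∑ j, gibbsPlan G st.2.1 st.2.2 i j = 1
  osc_left : ∀ i k, st.2.1 i - st.2.1 k ≤ ρ
  osc_right : ∀ i k, st.2.2 i - st.2.2 k ≤ ρ
  cols : st.1 = true → ∀ j, ∑ i, gibbsPlan G st.2.1 st.2.2 i j = b j
  rows : st.1 = false → ∀ i, ∑ j, gibbsPlan G st.2.1 st.2.2 i j = a i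

/-- The total mass is `1` before and after the update, so the objective drops by exactly the
relative entropy of `a` with respect to the row sums. As the columns already match, the marginal
error is the row error alone. -/
theorem dualObjective_rowUpdate_le [Nonempty ι] {G : Matrix ι ι ℝ} {a b u v : ι → ℝ}
    (ha : ∀ i, 0 < a i) (ha1 : ∑ i, a i = 1) (hmass : ∑ i, ∑ j, gibbsPlan G u v i j = 1)
    (hcols : ∀ j, ∑ i, gibbsPlan G u v i j = b j) :
    dualObjective G a b (rowUpdate G a u v) v ≤
      dualObjective G a b u v - marginalError (gibbsPlan G u v) a b ^ 2 / 4 := by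
  have h1 := sq_sum_abs_sub_le_kl ha (sum_gibbsPlan_pos G u v) ha1 hmass
  have h2 : marginalError (gibbsPlan G u v) a b = ∑ i, |∑ j, gibbsPlan G u v i j - a i| := by
    simp [marginalError, hcols]
  have h3 : ∑ i, rowUpdate G a u v i * a i = ∑ i, u i * a i +
      ∑ i, a i * (Real.log (a i) - Real.log (∑ j, gibbsPlan G u v i j)) := by
    rw [← Finset.sum_add_distrib]
    refine Finset.sum_congr rfl fun i _ => ?_
    simp only [rowUpdate]; ring
  rw [h2]
  simp only [dualObjective, sum_gibbsPlan_rowUpdate G u v ha, ha1, hmass, h3]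
  linarith

/-- The first-order bound for the convex dual objective. -/
theorem dualObjective_sub_le {G : Matrix ι ι ℝ} {a b : ι → ℝ} (u v u' v' : ι → ℝ) :
    dualObjective G a b u v - dualObjective G a b u' v' ≤
      ∑ i, (u i - u' i) * (∑ j, gibbsPlan G u v i j - a i) +
      ∑ j, (v j - v' j) * (∑ i, gibbsPlan G u v i j - b j) := by
  have h : ∀ i j, gibbsPlan G u v i j - gibbsPlan G u' v' i j ≤
      (u i - u' i) * gibbsPlan G u v i j + (v j - v' j) * gibbsPlan G u v i j := by
    intro i j
    have e : gibbsPlan G u' v' i j =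
        gibbsPlan G u v i j * Real.exp (-((u i - u' i) + (v j - v' j))) := by
      simp only [gibbsPlan, Matrix.of_apply, ← Real.exp_add]
      ring_nf
    have := mul_le_mul_of_nonneg_left
      (Real.add_one_le_exp (-((u i - u' i) + (v j - v' j)))) (gibbsPlan_pos G u v i j).le
    rw [e]
    linarith
  have hs := Finset.sum_le_sum fun i (_ : i ∈ Finset.univ) =>
    Finset.sum_le_sum fun j (_ : j ∈ Finset.univ) => h i j
  simp only [Finset.sum_add_distrib, Finset.sum_sub_distrib] at hs
  rw [Finset.sum_comm (f := fun i j => (v j - v' j) * gibbsPlan G u v i j)] at hs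
  simp only [dualObjective, mul_sub, sub_mul, Finset.sum_sub_distrib, Finset.mul_sum] at hs ⊢
  linarith

/-- In the first-order bound both marginal defects have sum zero, as all masses are `1`, and the
differences of dual variables have oscillation at most `2 * ρ`. -/
theorem IsBalanced.dualObjective_sub_le {G : Matrix ι ι ℝ} {a b : ι → ℝ} {ρ : ℝ}
    {st st' : Bool × (ι → ℝ) × (ι → ℝ)} (ha1 : ∑ i, a i = 1) (hb1 : ∑ j, b j = 1)
    (h : IsBalanced G a b ρ st) (h' : IsBalanced G a b ρ st') :
    dualObjective G a b st.2.1 st.2.2 - dualObjective G a b st'.2.1 st'.2.2 ≤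
      2 * ρ * marginalError (gibbsPlan G st.2.1 st.2.2) a b := by
  refine (POT.dualObjective_sub_le _ _ _ _).trans ?_
  rw [marginalError, mul_add]
  refine add_le_add (sum_mul_le_of_osc (fun i k => ?_) ?_) (sum_mul_le_of_osc (fun i k => ?_) ?_)
  · linarith [h.osc_left i k, h'.osc_left k i]
  · rw [Finset.sum_sub_distrib, h.mass, ha1, sub_self]
  · linarith [h.osc_right i k, h'.osc_right k i]
  · rw [Finset.sum_sub_distrib, ← sum_sum_comm, h.mass, hb1, sub_self]

/-- The side just rescaled matches its marginal, which fixes the mass and bounds the oscillation of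
its variable afresh; the other variable is unchanged. Only oscillation bounds are assumed, so the
lemma also applies to the zero start. -/
theorem isBalanced_step [Nonempty ι] {G : Matrix ι ι ℝ} {a b : ι → ℝ} {g α : ℝ}
    (hG0 : ∀ i j, 0 ≤ G i j) (hGg : ∀ i j, G i j ≤ g) (hα : 0 < α) (haα : ∀ i, α ≤ a i)
    (hbα : ∀ j, α ≤ b j) (ha1 : ∑ i, a i = 1) (hb1 : ∑ j, b j = 1)
    {st : Bool × (ι → ℝ) × (ι → ℝ)} (hu : ∀ i k, st.2.1 i - st.2.1 k ≤ g - Real.log α)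
    (hv : ∀ i k, st.2.2 i - st.2.2 k ≤ g - Real.log α) :
    IsBalanced G a b (g - Real.log α) (sinkhornStep G a b st) := by
  have hle : ∀ {a : ι → ℝ}, (∀ i, α ≤ a i) → ∑ i, a i = 1 → ∀ i, a i ≤ 1 := fun h h1 i =>
    h1 ▸ Finset.single_le_sum (fun i _ => hα.le.trans (h i)) (Finset.mem_univ i)
  obtain ⟨turn, u, v⟩ := st
  cases turn
  · have hr : ∀ j, ∑ i, gibbsPlan G u (rowUpdate G.transpose b v u) i j = b j := by
      intro j
      have := sum_gibbsPlan_rowUpdate G.transpose v u (fun j => hα.trans_le (hbα j)) j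
      rwa [gibbsPlan_transpose] at this
    refine ⟨?_, hu, ?_, fun _ => hr, fun h => by simp [sinkhornStep] at h⟩
    · show ∑ i, ∑ j, gibbsPlan G u (rowUpdate G.transpose b v u) i j = 1
      rw [sum_sum_comm]
      simp only [hr, hb1]
    · refine osc_le_of_rows_eq (G := G.transpose) (a := b) (v := u) (fun i j => hG0 j i)
        (fun i j => hGg j i) hα hbα (hle hbα hb1) fun j => ?_
      exact sum_gibbsPlan_rowUpdate G.transpose v u (fun j => hα.trans_le (hbα j)) j
  · have hr := sum_gibbsPlan_rowUpdate G u v (fun i => hα.trans_le (haα i))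
    refine ⟨?_, osc_le_of_rows_eq hG0 hGg hα haα (hle haα ha1) hr, hv,
      fun h => by simp [sinkhornStep] at h, fun _ => hr⟩
    show ∑ i, ∑ j, gibbsPlan G (rowUpdate G a u v) v i j = 1
    simp only [hr, ha1]

theorem IsBalanced.dualObjective_step_le [Nonempty ι] {G : Matrix ι ι ℝ} {a b : ι → ℝ} {ρ : ℝ}
    (ha : ∀ i, 0 < a i) (hb : ∀ j, 0 < b j) (ha1 : ∑ i, a i = 1) (hb1 : ∑ j, b j = 1)
    {st : Bool × (ι → ℝ) × (ι → ℝ)} (h : IsBalanced G a b ρ st) :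
    dualObjective G a b (sinkhornStep G a b st).2.1 (sinkhornStep G a b st).2.2 ≤
      dualObjective G a b st.2.1 st.2.2 -
        marginalError (gibbsPlan G st.2.1 st.2.2) a b ^ 2 / 4 := by
  obtain ⟨turn, u, v⟩ := st
  cases turn
  -- A column update is a row update of the transposed problem.
  · have := dualObjective_rowUpdate_le (G := G.transpose) (a := b) (b := a) (u := v) (v := u) hb hb1
      (by rw [gibbsPlan_transpose]; simpa [Finset.sum_comm (γ := ι)] using h.mass)
      (by rw [gibbsPlan_transpose]; exact h.rows rfl)
    rwa [dualObjective_transpose, dualObjective_transpose, gibbsPlan_transpose,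
      marginalError_transpose] at this
  · exact dualObjective_rowUpdate_le ha ha1 h.mass (h.cols rfl)

/-- Sinkhorn's iteration reaches marginal error `tol` within `O((g - log α) / tol)` steps. -/
theorem exists_marginalError_le [Nonempty ι] {G : Matrix ι ι ℝ} {a b : ι → ℝ} {g α tol : ℝ}
    (hG0 : ∀ i j, 0 ≤ G i j) (hGg : ∀ i j, G i j ≤ g) (hα : 0 < α) (haα : ∀ i, α ≤ a i)
    (hbα : ∀ j, α ≤ b j) (ha1 : ∑ i, a i = 1) (hb1 : ∑ j, b j = 1) (htol : 0 < tol)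
    (hpos : 0 < g - Real.log α) {h : ℕ} (hh : 8 * (g - Real.log α) < h * tol) :
    ∃ k ≤ 2 * h, marginalError (gibbsPlan G
      ((sinkhornStep G a b)^[k] (true, 0, 0)).2.1 ((sinkhornStep G a b)^[k] (true, 0, 0)).2.2)
        a b ≤ tol := by
  set st : ℕ → Bool × (ι → ℝ) × (ι → ℝ) := fun k => (sinkhornStep G a b)^[k] (true, 0, 0) with hst
  have hsucc : ∀ k, st (k + 1) = sinkhornStep G a b (st k) := fun k =>
    Function.iterate_succ_apply' _ _ _
  have hbal : ∀ k, IsBalanced G a b (g - Real.log α) (st (k + 1)) := by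
    intro k
    induction k with
    | zero =>
      rw [hsucc]
      exact isBalanced_step hG0 hGg hα haα hbα ha1 hb1 (fun i k => by simpa [hst] using hpos.le)
        (fun i k => by simpa [hst] using hpos.le)
    | succ k ih =>
      rw [hsucc]
      exact isBalanced_step hG0 hGg hα haα hbα ha1 hb1 ih.osc_left ih.osc_right
  -- The sequence starts after the first update, because the initial plan need not have mass `1`.
  obtain ⟨k, hk, hk'⟩ := exists_error_le_of_potential
    (Δ := fun k => dualObjective G a b (st (k + 1)).2.1 (st (k + 1)).2.2)
    (e := fun k => marginalError (gibbsPlan G (st (k + 1)).2.1 (st (k + 1)).2.2) a b)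
    (ρ := 2 * (g - Real.log α)) (h := h) (by linarith) htol
    (fun k => by
      have := (hbal k).dualObjective_step_le (fun i => hα.trans_le (haα i))
        (fun i => hα.trans_le (hbα i)) ha1 hb1
      rwa [← hsucc] at this)
    (fun k _ => (hbal k).dualObjective_sub_le ha1 hb1 (hbal (2 * h))) (by linarith)
  exact ⟨k + 1, by omega, hk'⟩

end Convergence

/-! Values and operation counts of the programs. -/

section Programs

@[simp] theorem Timed.bind_val {α β : Type} (x : Timed α) (f : α → Timed β) :
    (x >>= f).val = (f x.val).val := rfl

@[simp] theorem Timed.bind_ops {α β : Type} (x : Timed α) (f : α → Timed β) :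
    (x >>= f).ops = x.ops + (f x.val).ops := rfl

@[simp] theorem Timed.pure_val {α : Type} (x : α) : (pure x : Timed α).val = x := rfl

@[simp] theorem Timed.pure_ops {α : Type} (x : α) : (pure x : Timed α).ops = 0 := rfl

variable {ι : Type} [Fintype ι]

theorem sinkhornLoop_val_succ (G : Matrix ι ι ℝ) (a b : ι → ℝ) (tol : ℝ) (cap : ℕ) (turn : Bool)
    (u v : ι → ℝ) :
    (sinkhornLoop G a b tol (cap + 1) turn u v).val =
      if marginalError (gibbsPlan G u v) a b ≤ tol then some (gibbsPlan G u v)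
      else (sinkhornLoop G a b tol cap (sinkhornStep G a b (turn, u, v)).1
        (sinkhornStep G a b (turn, u, v)).2.1 (sinkhornStep G a b (turn, u, v)).2.2).val := by
  have key : ∀ {α : Type} (p : Prop) [Decidable p] (x y : Timed α),
      (if p then x else y).val = if p then x.val else y.val := by
    intros; split <;> rfl
  cases turn
  · simp only [sinkhornLoop, Timed.bind_val, key, leOp, decide_eq_true_eq]
    have : (rowUpdate G.transpose b v u) = fun j => v j + (Real.log (b j) -
        Real.log (∑ i, gibbsPlan G u v i j)) := by
      ext j; simp only [rowUpdate, gibbsPlan_transpose, Matrix.transpose_apply]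
    simp only [sinkhornStep, this]
    rfl
  · simp only [sinkhornLoop, Timed.bind_val, key, leOp, decide_eq_true_eq]
    rfl

/-- A pass forms `B` with `4N²` operations and both marginals with `2N² + 2N`; the differences and
their norms take `8N`, the test `2`, and the update of one dual variable `5N`. -/
theorem sinkhornLoop_ops_le (G : Matrix ι ι ℝ) (a b : ι → ℝ) (tol : ℝ) (cap : ℕ) (turn : Bool)
    (u v : ι → ℝ) : (sinkhornLoop G a b tol cap turn u v).ops ≤
      cap * (6 * Fintype.card ι ^ 2 + 15 * Fintype.card ι + 2) := by
  have key : ∀ {α : Type} (p : Prop) [Decidable p] (x y : Timed α) (z : ℕ), x.ops ≤ z → y.ops ≤ z →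
      (if p then x else y).ops ≤ z := by
    intros; split <;> assumption
  induction cap generalizing turn u v with
  | zero => simp [sinkhornLoop]
  | succ cap ih =>
    rw [add_mul, one_mul]
    cases turn <;>
    simp only [sinkhornLoop, Timed.bind_ops, Timed.bind_val, tabulate, tabulateMatrix, addOp, subOp,
      expOp, logOp, sumOp, normOneOp, leOp, Finset.sum_const, Finset.card_univ, smul_eq_mul,
      decide_eq_true_eq, if_true, if_false, Bool.false_eq_true] <;>
    refine le_trans (add_le_add_right (add_le_add_right (add_le_add_right (add_le_add_right
      (add_le_add_right (add_le_add_right (add_le_add_right (add_le_add_right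
      (add_le_add_right (key _ _ _ _ (Nat.zero_le _) (add_le_add_right (ih _ _ _) _))
        _) _) _) _) _) _) _) _) _) ?_ <;>
    nlinarith

/-- The loop may stop before iterate `k`; that iterate only guarantees a stop below the cap. What
matters later is that the returned matrix is a Gibbs plan passing the test. -/
theorem sinkhornLoop_spec (G : Matrix ι ι ℝ) (a b : ι → ℝ) (tol : ℝ) (k : ℕ) (cap : ℕ)
    (st : Bool × (ι → ℝ) × (ι → ℝ)) (hk : k < cap)
    (herr : marginalError (gibbsPlan G ((sinkhornStep G a b)^[k] st).2.1
      ((sinkhornStep G a b)^[k] st).2.2) a b ≤ tol) :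
    ∃ u v, (sinkhornLoop G a b tol cap st.1 st.2.1 st.2.2).val = some (gibbsPlan G u v) ∧
      marginalError (gibbsPlan G u v) a b ≤ tol := by
  induction cap generalizing k st with
  | zero => omega
  | succ cap ih =>
    rw [sinkhornLoop_val_succ]
    split_ifs with h
    · exact ⟨_, _, rfl, h⟩
    · cases k with
      | zero => exact absurd herr h
      | succ k => exact ih k _ (by omega) herr

theorem sinkhorn_val (M : Matrix ι ι ℝ) (a b : ι → ℝ) (ε : ℝ) (cap : ℕ) :
    (sinkhorn M a b ε cap).val =
      (sinkhornLoop
        (Matrix.of fun i j => M i j / (ε / (4 * Real.log (Fintype.card ι))))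
        (smooth a (min 1 (ε / (8 * maxNorm M)))).val (smooth b (min 1 (ε / (8 * maxNorm M)))).val
        (min 1 (ε / (8 * maxNorm M)) / 2) cap true 0 0).val := rfl

theorem sinkhorn_ops_le (M : Matrix ι ι ℝ) (a b : ι → ℝ) (ε : ℝ) (cap : ℕ) :
    (sinkhorn M a b ε cap).ops ≤ 4 * Fintype.card ι ^ 2 + 8 * Fintype.card ι + 13 +
      cap * (6 * Fintype.card ι ^ 2 + 15 * Fintype.card ι + 2) := by
  have : (sinkhorn M a b ε cap).ops = 4 * Fintype.card ι ^ 2 + 8 * Fintype.card ι + 13 +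
      (sinkhornLoop
        (Matrix.of fun i j => M i j / (ε / (4 * Real.log (Fintype.card ι))))
        (smooth a (min 1 (ε / (8 * maxNorm M)))).val (smooth b (min 1 (ε / (8 * maxNorm M)))).val
        (min 1 (ε / (8 * maxNorm M)) / 2) cap true 0 0).ops := by
    simp only [sinkhorn, smooth, Timed.bind_ops, Timed.bind_val, tabulate, tabulateMatrix, addOp,
      subOp, mulOp, divOp, minOp, maxNormOp, logOp, Finset.sum_const, Finset.card_univ, smul_eq_mul,
      Timed.pure_val, Timed.pure_ops]
    rw [show (fun _ => 0 : ι → ℝ) = 0 from rfl]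
    ring
  rw [this]
  exact add_le_add_right (sinkhornLoop_ops_le _ _ _ _ _ _ _ _) _

variable {n : ℕ}

theorem enforceLoop_ops_le (r : Fin n → ℝ) (target : ℝ) (l : List (Fin n)) (p : Fin n → ℝ)
    (tot : ℝ) (last : Option (Fin n)) :
    (enforceLoop r target l p tot last).ops ≤ 3 * l.length := by
  induction l generalizing p tot last with
  | nil => simp [enforceLoop]
  | cons i l ih =>
    simp only [enforceLoop, Timed.bind_ops, leOp, subOp, addOp, decide_eq_true_eq,
      List.length_cons]
    split_ifs
    · simp only [Timed.bind_ops]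
      have := ih (Function.update p i (r i)) (tot + (r i - p i)) (some i)
      omega
    · simp; omega

/-- The loop of the enforcing procedure raises entries to their upper bounds until the total
exceeds the target; the last entry raised can absorb the excess. -/
theorem enforceLoop_spec (r : Fin n → ℝ) (target : ℝ) (l : List (Fin n)) (p : Fin n → ℝ)
    (tot : ℝ) (last : Option (Fin n)) (hp : ∀ i, p i ≤ r i) (htot : tot = ∑ i, p i) :
    let res := (enforceLoop r target l p tot last).val
    res.2.1 = ∑ i, res.1 i ∧ (∀ i, p i ≤ res.1 i) ∧ (∀ i, res.1 i ≤ r i) ∧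
    ((res.2.2 = last ∧ res.1 = p ∧ (l = [] ∨ target < tot)) ∨
      ∃ i, res.2.2 = some i ∧ p i ≤ res.1 i - (res.2.1 - target)) ∧
    (target < res.2.1 ∨ ∀ i ∈ l, res.1 i = r i) := by
  induction l generalizing p tot last with
  | nil => simp [enforceLoop, htot, hp]
  | cons i l ih =>
    by_cases h : tot ≤ target
    · have e : (enforceLoop r target (i :: l) p tot last).val =
          (enforceLoop r target l (Function.update p i (r i)) (tot + (r i - p i)) (some i)).val := by
        simp [enforceLoop, leOp, h, subOp, addOp]
      rw [e]
      have hpu : ∀ k, p k ≤ Function.update p i (r i) k := fun k => by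
        by_cases hk : k = i
        · subst hk; simpa using hp k
        · simp [hk]
      have hur : ∀ k, Function.update p i (r i) k ≤ r k := fun k => by
        by_cases hk : k = i
        · subst hk; simp
        · simpa [hk] using hp k
      have hsum : tot + (r i - p i) = ∑ k, Function.update p i (r i) k := by
        rw [Finset.sum_update_of_mem (Finset.mem_univ i), htot,
          ← Finset.add_sum_erase _ p (Finset.mem_univ i), Finset.sdiff_singleton_eq_erase]
        ring
      obtain ⟨h1, h2, h3, h4, h5⟩ := ih _ _ (some i) hur hsum
      generalize (enforceLoop r target l (Function.update p i (r i)) (tot + (r i - p i))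
        (some i)).val = res at *
      have hi : res.1 i = r i := le_antisymm (h3 i) (by simpa using h2 i)
      refine ⟨h1, fun k => (hpu k).trans (h2 k), h3, Or.inr ?_, ?_⟩
      -- If `i` is the last index replaced, the total before was at most `target`, so the excess is
      -- at most the increment `r i - p i`.
      · rcases h4 with ⟨h6, h7, -⟩ | ⟨k, h6, h7⟩
        · refine ⟨i, h6, ?_⟩
          rw [hi, h1, h7, ← hsum]
          linarith
        · exact ⟨k, h6, (hpu k).trans h7⟩
      · refine h5.imp id fun h5 k hk => ?_
        rcases List.mem_cons.1 hk with rfl | hk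
        · exact hi
        · exact h5 k hk
    · have e : (enforceLoop r target (i :: l) p tot last).val = (p, tot, last) := by
        simp [enforceLoop, leOp, h]
      rw [e]
      push Not at h
      exact ⟨htot, fun _ => le_rfl, hp, Or.inl ⟨rfl, rfl, Or.inr h⟩, Or.inl h⟩

theorem enforce_val (r : Fin n → ℝ) (s : ℝ) (p : Fin n → ℝ) :
    (enforce r s p).val =
      if ∑ i, |min (p i) (r i)| ≤ ∑ i, |r i| - s then
        let res := (enforceLoop r (∑ i, |r i| - s) (List.finRange n) (fun i => min (p i) (r i))
          (∑ i, |min (p i) (r i)|) none).val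
        match res.2.2 with
        | none => res.1
        | some i => Function.update res.1 i (res.1 i - (res.2.1 - (∑ i, |r i| - s)))
      else fun i => (∑ i, |r i| - s) / (∑ i, |min (p i) (r i)|) * min (p i) (r i) := by
  simp only [enforce, Timed.bind_val, leOp, decide_eq_true_eq, normOneOp, subOp, tabulate, minOp]
  split_ifs
  · simp only [Timed.bind_val]
    generalize (enforceLoop r (∑ i, |r i| - s) (List.finRange n) (fun i => min (p i) (r i))
      (∑ i, |min (p i) (r i)|) none).val = res
    obtain ⟨y, t, _ | i⟩ := res <;> rfl
  · rfl

/-- The enforcing procedure returns a vector between `0` and `r` of mass `‖r‖₁ - s`, and its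
entries do not exceed those of `p` by more than the missing mass. -/
theorem enforce_spec {r p : Fin n → ℝ} {s : ℝ} (hn : 0 < n) (hr : ∀ i, 0 ≤ r i) (hp : ∀ i, 0 ≤ p i)
    (hs : 0 ≤ s) (hsr : s ≤ ∑ i, r i) :
    (∀ i, 0 ≤ (enforce r s p).val i) ∧ (∀ i, (enforce r s p).val i ≤ r i) ∧
    ∑ i, (enforce r s p).val i = ∑ i, r i - s ∧
    ∑ i, max 0 ((enforce r s p).val i - p i) ≤ max 0 (∑ i, r i - s - ∑ i, min (p i) (r i)) := by
  rw [enforce_val]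
  have h0 : ∀ i, 0 ≤ min (p i) (r i) := fun i => le_min (hp i) (hr i)
  simp only [abs_of_nonneg (h0 _), abs_of_nonneg (hr _)]
  set P := ∑ i, min (p i) (r i) with hP
  set target := ∑ i, r i - s with ht
  split_ifs with h
  · obtain ⟨h1, h2, h3, h4, h5⟩ := enforceLoop_spec r target (List.finRange n)
      (fun i => min (p i) (r i)) P none (fun i => min_le_right _ _) rfl
    generalize (enforceLoop r target (List.finRange n) (fun i => min (p i) (r i)) P none).val
      = res at *
    -- At least one entry is replaced: there is an index, and the loop starts with a total not above
    -- the target.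
    obtain ⟨i, hi, hi'⟩ : ∃ i, res.2.2 = some i ∧
        min (p i) (r i) ≤ res.1 i - (res.2.1 - target) := by
      rcases h4 with ⟨-, -, h6 | h6⟩ | h6
      · have := congrArg List.length h6
        simp at this; omega
      · exact absurd h6 (not_lt.2 h)
      · exact h6
    -- If the loop exhausts all indices, the total is `∑ i, r i`, which is at least the target
    -- because `s ≥ 0`.
    have hex : 0 ≤ res.2.1 - target := by
      rcases h5 with h5 | h5
      · linarith
      · have : ∑ i, res.1 i = ∑ i, r i := Finset.sum_congr rfl fun i _ => h5 i (List.mem_finRange i)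
        rw [h1, this]; linarith
    simp only [hi]
    set y := Function.update res.1 i (res.1 i - (res.2.1 - target)) with hy
    have hlow : ∀ k, min (p k) (r k) ≤ y k := fun k => by
      by_cases hk : k = i
      · subst hk; simpa [hy] using hi'
      · simpa [hy, hk] using h2 k
    have hupp : ∀ k, y k ≤ r k := fun k => by
      by_cases hk : k = i
      · subst hk; simp only [hy, Function.update_self]; linarith [h3 k]
      · simpa [hy, hk] using h3 k
    have hsum : ∑ k, y k = target := by
      have := Finset.add_sum_erase _ res.1 (Finset.mem_univ i)
      rw [hy, Finset.sum_update_of_mem (Finset.mem_univ i), Finset.sdiff_singleton_eq_erase]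
      linarith
    refine ⟨fun k => (h0 k).trans (hlow k), hupp, hsum, le_max_of_le_right ?_⟩
    rw [← hsum, hP, ← Finset.sum_sub_distrib]
    refine Finset.sum_le_sum fun k _ => max_le (sub_nonneg.2 (hlow k)) ?_
    exact sub_le_sub_left (min_le_left _ _) _
  · push Not at h
    have ht0 : 0 ≤ target := by linarith
    have hP0 : 0 < P := ht0.trans_lt h
    have hle : ∀ i, target / P * min (p i) (r i) ≤ min (p i) (r i) := fun i =>
      mul_le_of_le_one_left (h0 i) ((div_le_one hP0).2 h.le)
    refine ⟨fun i => mul_nonneg (div_nonneg ht0 hP0.le) (h0 i),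
      fun i => (hle i).trans (min_le_right _ _), ?_, le_max_of_le_left (le_of_eq ?_)⟩
    · rw [← Finset.mul_sum, ← hP, div_mul_cancel₀ _ hP0.ne']
    · refine Finset.sum_eq_zero fun i _ => max_eq_left ?_
      linarith [(hle i).trans (min_le_left _ _)]

theorem enforce_ops_le (r : Fin n → ℝ) (s : ℝ) (p : Fin n → ℝ) :
    (enforce r s p).ops ≤ 9 * n + 5 := by
  simp only [enforce, Timed.bind_ops, leOp, decide_eq_true_eq, normOneOp, subOp,
    tabulate, minOp]
  split_ifs
  · simp only [Timed.bind_ops]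
    have h := enforceLoop_ops_le r (∑ i, |r i| - s) (List.finRange n) (fun i => min (p i) (r i))
      (∑ i, |min (p i) (r i)|) none
    simp only [List.length_finRange] at h
    split <;> simp <;> omega
  · simp [divOp, mulOp]; omega

theorem roundPOT_val (X : Matrix (Fin n) (Fin n) ℝ) (p q r c : Fin n → ℝ) (s : ℝ) :
    (roundPOT X p q r c s).val =
      roundPlan X (fun i => r i - (enforce r s p).val i) (fun j => c j - (enforce c s q).val j) := rfl

theorem roundPOT_ops_le (X : Matrix (Fin n) (Fin n) ℝ) (p q r c : Fin n → ℝ) (s : ℝ) :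
    (roundPOT X p q r c s).ops ≤ 11 * n ^ 2 + 38 * n + 10 := by
  have h1 := enforce_ops_le r s p
  have h2 := enforce_ops_le c s q
  simp only [roundPOT, Timed.bind_ops, Timed.bind_val, normOneOp, subOp, addOp, mulOp, divOp, sumOp,
    tabulate, tabulateMatrix, minOp, Finset.sum_const, Finset.card_univ, smul_eq_mul,
    Fintype.card_fin]
  nlinarith

end Programs

/-! Accuracy of the approximate plans. -/

section Accuracy

theorem smooth_val {ι : Type} [Fintype ι] (a : ι → ℝ) (δ : ℝ) (i : ι) :
    (smooth a δ).val i = (1 - δ / 8) * a i + δ / 8 / Fintype.card ι := rfl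

theorem sum_smooth {ι : Type} [Fintype ι] [Nonempty ι] {a : ι → ℝ} (ha : ∑ i, a i = 1) (δ : ℝ) :
    ∑ i, (smooth a δ).val i = 1 := by
  have hN : (Fintype.card ι : ℝ) ≠ 0 := Nat.cast_ne_zero.2 Fintype.card_ne_zero
  simp only [smooth_val, Finset.sum_add_distrib, ← Finset.mul_sum, ha, Finset.sum_const,
    Finset.card_univ, nsmul_eq_mul]
  field_simp
  ring

/-- This lower bound on the smoothed marginals is the `α` in the oscillation bound; it is the
purpose of the smoothing. -/
theorem le_smooth {ι : Type} [Fintype ι] {a : ι → ℝ} (ha : ∀ i, 0 ≤ a i) {δ : ℝ} (hδ : δ ≤ 1)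
    (i : ι) : δ / 8 / Fintype.card ι ≤ (smooth a δ).val i := by
  rw [smooth_val]
  have := mul_nonneg (by linarith : 0 ≤ 1 - δ / 8) (ha i)
  linarith

/-- Smoothing removes mass `δ / 8` and adds mass `δ / 8`, hence moves the marginal by at most `δ /
4`. -/
theorem sum_abs_sub_le_smooth {ι : Type} [Fintype ι] [Nonempty ι] {a x : ι → ℝ}
    (ha : ∀ i, 0 ≤ a i) (ha1 : ∑ i, a i = 1) {δ : ℝ} (hδ : 0 ≤ δ) :
    ∑ i, |x i - a i| ≤ ∑ i, |x i - (smooth a δ).val i| + δ / 4 := by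
  have hN : (0 : ℝ) < Fintype.card ι := Nat.cast_pos.2 Fintype.card_pos
  have h : ∀ i, |x i - a i| ≤
      |x i - (smooth a δ).val i| + (δ / 8 / Fintype.card ι + δ / 8 * a i) := by
    intro i
    have e : x i - a i = (x i - (smooth a δ).val i) + (δ / 8 / Fintype.card ι - δ / 8 * a i) := by
      rw [smooth_val]; ring
    rw [e]
    refine (abs_add_le _ _).trans (add_le_add_right ?_ _)
    have h1 : 0 ≤ δ / 8 / Fintype.card ι := by positivity
    have h2 : 0 ≤ δ / 8 * a i := mul_nonneg (by positivity) (ha i)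
    exact abs_le.2 ⟨by linarith, by linarith⟩
  refine (Finset.sum_le_sum fun i _ => h i).trans ?_
  simp only [Finset.sum_add_distrib, ← Finset.mul_sum, ha1, Finset.sum_const, Finset.card_univ,
    nsmul_eq_mul]
  field_simp
  linarith

/-- A Gibbs plan for the parameters of `sinkhorn` that meets its stopping criterion is accurate. -/
theorem sinkhorn_accuracy {ι : Type} [Fintype ι] [Nontrivial ι] {M : Matrix ι ι ℝ} {a b : ι → ℝ}
    {m ε δ : ℝ} (hM0 : ∀ i j, 0 ≤ M i j) (hMm : ∀ i j, M i j ≤ m) (hm : 0 < m) (hε : 0 < ε)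
    (ha : ∀ i, 0 ≤ a i) (hb : ∀ j, 0 ≤ b j) (ha1 : ∑ i, a i = 1) (hb1 : ∑ j, b j = 1)
    (hδ : δ = min 1 (ε / (8 * m))) {B : Matrix ι ι ℝ} {u v : ι → ℝ}
    (hB : B = gibbsPlan (Matrix.of fun i j => M i j / (ε / (4 * Real.log (Fintype.card ι)))) u v)
    (herr : marginalError B (smooth a δ).val (smooth b δ).val ≤ δ / 2) :
    marginalError B a b ≤ δ ∧
    ∀ P : Matrix ι ι ℝ, (∀ i j, 0 ≤ P i j) → (∀ i, ∑ j, P i j = a i) → (∀ j, ∑ i, P i j = b j) →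
      ∑ i, ∑ j, M i j * B i j ≤ ∑ i, ∑ j, M i j * P i j + 11 / 16 * ε := by
  have hδ0 : 0 ≤ δ := hδ ▸ le_min zero_le_one (by positivity)
  have hδ1 : δ ≤ 1 := hδ ▸ min_le_left _ _
  have hδm : m * δ ≤ ε / 8 := by
    calc m * δ ≤ m * (ε / (8 * m)) := by
          gcongr; exact hδ ▸ min_le_right _ _
      _ = ε / 8 := by field_simp
  have hB0 : ∀ i j, 0 < B i j := fun i j => hB ▸ gibbsPlan_pos _ u v i j
  have hl : 0 < Real.log (Fintype.card ι) :=
    Real.log_pos (by exact_mod_cast Fintype.one_lt_card (α := ι))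
  have h1 : marginalError B a b ≤ δ := by
    have e1 := sum_abs_sub_le_smooth (x := fun i => ∑ j, B i j) ha ha1 hδ0
    have e2 := sum_abs_sub_le_smooth (x := fun j => ∑ i, B i j) hb hb1 hδ0
    simp only [marginalError] at herr ⊢
    linarith
  refine ⟨h1, fun P hP hPa hPb => ?_⟩
  set t := ∑ i, ∑ j, B i j with ht
  -- The excess mass is bounded by the row error and by the column error, so by half their sum.
  have htle : t - 1 ≤ δ / 4 := by
    have e1 : t - 1 ≤ ∑ i, |∑ j, B i j - (smooth a δ).val i| := by
      rw [← sum_smooth ha1 δ, ht, ← Finset.sum_sub_distrib]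
      exact Finset.sum_le_sum fun i _ => le_abs_self _
    have e2 : t - 1 ≤ ∑ j, |∑ i, B i j - (smooth b δ).val j| := by
      rw [← sum_smooth hb1 δ, ht, sum_sum_comm, ← Finset.sum_sub_distrib]
      exact Finset.sum_le_sum fun i _ => le_abs_self _
    rw [marginalError] at herr
    linarith
  -- With positive parts in this form, the mass terms in the rounding bound cancel and half of the
  -- marginal error remains: `m * (δ / 2) ≤ ε / 16`.
  have hmax : ∀ x : ℝ, max 0 x = (x + |x|) / 2 := fun x => by
    rcases le_total 0 x with h | h
    · rw [max_eq_right h, abs_of_nonneg h]; ring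
    · rw [max_eq_left h, abs_of_nonpos h]; ring
  obtain ⟨hY0, hYr, hYc, hYcost⟩ := roundPlan_spec (X := P) (r := fun i => ∑ j, B i j)
    (c := fun j => ∑ i, B i j) hP (fun i => Finset.sum_nonneg fun j _ => (hB0 i j).le)
    (fun j => Finset.sum_nonneg fun i _ => (hB0 i j).le) (sum_sum_comm B)
  have hcost := hYcost M m hM0 hMm hm.le
  set Y := roundPlan P (fun i => ∑ j, B i j) fun j => ∑ i, B i j
  have h2 : ∑ i, ∑ j, M i j * Y i j ≤ ∑ i, ∑ j, M i j * P i j + ε / 16 := by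
    simp only [hPa, hPb, ha1, hmax, ← Finset.sum_div, Finset.sum_add_distrib,
      Finset.sum_sub_distrib, hb1] at hcost
    rw [← ht, ← sum_sum_comm, ← ht] at hcost
    simp only [marginalError, abs_sub_comm _ (a _), abs_sub_comm _ (b _)] at h1
    refine hcost.trans (add_le_add_right ?_ _)
    calc _ ≤ m * (δ / 2) := by
          refine mul_le_mul_of_nonneg_left ?_ hm.le
          linarith
      _ ≤ ε / 16 := by linarith
  have h3 := gibbsPlan_cost_le (u := u) (v := v)
    (G := Matrix.of fun i j => M i j / (ε / (4 * Real.log (Fintype.card ι)))) (Y := Y) hY0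
    (by rw [← hB]; exact hYr) (by rw [← hB]; exact hYc)
  rw [← hB, ← ht] at h3
  have hdiv : ∀ Z : Matrix ι ι ℝ, ∑ i, ∑ j, M i j / (ε / (4 * Real.log (Fintype.card ι))) * Z i j =
      (∑ i, ∑ j, M i j * Z i j) * (4 * Real.log (Fintype.card ι) / ε) := by
    intro Z
    simp only [Finset.sum_mul]
    refine Finset.sum_congr rfl fun i _ => Finset.sum_congr rfl fun j _ => ?_
    field_simp
  simp only [Matrix.of_apply, hdiv] at h3
  have h4 : ∑ i, ∑ j, M i j * B i j ≤ ∑ i, ∑ j, M i j * Y i j + t * ε / 2 := by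
    refine le_of_mul_le_mul_right (h3.trans_eq ?_)
      (by positivity : 0 < 4 * Real.log (Fintype.card ι) / ε)
    field_simp
    ring
  -- From `t ≤ 5 / 4` the entropy term is at most `5 / 8 * ε`; adding `ε / 16` gives `11 / 16 * ε`.
  nlinarith

/-- Round-POT turns blocks of an approximately feasible extended plan into a feasible plan whose
cost is controlled by the corner `w` and the total marginal error `η`. -/
theorem roundPOT_spec {n : ℕ} {C X : Matrix (Fin n) (Fin n) ℝ} {p q r c : Fin n → ℝ} {s w η m : ℝ}
    (hn : 0 < n) (hC0 : ∀ i j, 0 ≤ C i j) (hCm : ∀ i j, C i j ≤ m) (hm : 0 ≤ m)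
    (hr : ∀ i, 0 ≤ r i) (hc : ∀ j, 0 ≤ c j) (hs : 0 ≤ s) (hsr : s ≤ ∑ i, r i)
    (hsc : s ≤ ∑ j, c j) (hX : ∀ i j, 0 ≤ X i j) (hp : ∀ i, 0 ≤ p i) (hq : ∀ j, 0 ≤ q j)
    (hw : 0 ≤ w)
    (herr : ∑ i, |∑ j, X i j + p i - r i| + |∑ j, q j + w - (∑ j, c j - s)| +
      (∑ j, |∑ i, X i j + q j - c j| + |∑ i, p i + w - (∑ i, r i - s)|) ≤ η) :
    (roundPOT X p q r c s).val ∈ feasibleSet r c s ∧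
      cost C (roundPOT X p q r c s).val ≤ cost C X + m * (w + 3 * η) := by
  obtain ⟨p0, pr, psum, pexc⟩ := enforce_spec hn hr hp hs hsr
  obtain ⟨q0, qc, qsum, qexc⟩ := enforce_spec hn hc hq hs hsc
  rw [roundPOT_val]
  set P := (enforce r s p).val
  set Q := (enforce c s q).val
  have hrs : ∑ i, (r i - P i) = s := by rw [Finset.sum_sub_distrib, psum]; ring
  have hcs : ∑ j, (c j - Q j) = s := by rw [Finset.sum_sub_distrib, qsum]; ring
  obtain ⟨h0, hrow, hcol, hcost⟩ := roundPlan_spec (X := X) (r := fun i => r i - P i)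
    (c := fun j => c j - Q j) hX (fun i => sub_nonneg.2 (pr i)) (fun j => sub_nonneg.2 (qc j))
    (hrs.trans hcs.symm)
  refine ⟨⟨h0, fun i => ?_, fun j => ?_, ?_⟩, ?_⟩
  · rw [hrow]; linarith [p0 i]
  · rw [hcol]; linarith [q0 j]
  · rw [← hrs]; exact Finset.sum_congr rfl fun i _ => hrow i
  refine (hcost C m hC0 hCm hm).trans (add_le_add_right (mul_le_mul_of_nonneg_left ?_ hm) _)
  rw [hrs]
  -- Here `x` stands for the row sums of `X`, `y` for `r`, `z` for `p`, `z'` for the enforced vector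
  -- and `τ` for its mass. The excess splits into the marginal error and the amount by which
  -- enforcing raised `z`; the latter is mass missing from `min z y`. The same holds for columns.
  have excess : ∀ (x y z z' : Fin n → ℝ) (t τ : ℝ), (∀ i, 0 ≤ x i) →
      ∑ i, max 0 (z' i - z i) ≤ max 0 (τ - ∑ i, min (z i) (y i)) →
      τ - ∑ i, z i ≤ t → 0 ≤ t →
      ∑ i, max 0 (x i - (y i - z' i)) ≤ t + 2 * ∑ i, |x i + z i - y i| := by
    intro x y z z' t τ hx hz ht ht0
    have hd : 0 ≤ ∑ i, |x i + z i - y i| := Finset.sum_nonneg fun i _ => abs_nonneg _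
    have e1 : ∑ i, max 0 (x i - (y i - z' i)) ≤
        ∑ i, |x i + z i - y i| + ∑ i, max 0 (z' i - z i) := by
      rw [← Finset.sum_add_distrib]
      refine Finset.sum_le_sum fun i _ => max_le ?_ ?_
      · exact add_nonneg (abs_nonneg _) (le_max_left _ _)
      · linarith [le_abs_self (x i + z i - y i), le_max_right 0 (z' i - z i)]
    have e2 : ∑ i, z i ≤ ∑ i, min (z i) (y i) + ∑ i, |x i + z i - y i| := by
      rw [← Finset.sum_add_distrib]
      refine Finset.sum_le_sum fun i _ => ?_
      rcases le_total (z i) (y i) with h | h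
      · rw [min_eq_left h]; linarith [abs_nonneg (x i + z i - y i)]
      · rw [min_eq_right h]; linarith [le_abs_self (x i + z i - y i), hx i]
    have e3 : max 0 (τ - ∑ i, min (z i) (y i)) ≤ t + ∑ i, |x i + z i - y i| :=
      max_le (by linarith) (by linarith)
    linarith
  have f1 := le_abs_self (∑ i, p i + w - (∑ i, r i - s))
  have f2 := neg_abs_le (∑ i, p i + w - (∑ i, r i - s))
  have g1 := le_abs_self (∑ j, q j + w - (∑ j, c j - s))
  have g2 := neg_abs_le (∑ j, q j + w - (∑ j, c j - s))
  have hx1 := excess (fun i => ∑ j, X i j) r p P (w + |∑ i, p i + w - (∑ i, r i - s)|)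
    (∑ i, r i - s) (fun i => Finset.sum_nonneg fun j _ => hX i j) pexc (by linarith)
    (by linarith [abs_nonneg (∑ i, p i + w - (∑ i, r i - s))])
  have hx2 := excess (fun j => ∑ i, X i j) c q Q (w + |∑ j, q j + w - (∑ j, c j - s)|)
    (∑ j, c j - s) (fun j => Finset.sum_nonneg fun i _ => hX i j) qexc (by linarith)
    (by linarith [abs_nonneg (∑ j, q j + w - (∑ j, c j - s))])
  -- With the error of the dummy column this bounds `s - ∑ X` by `-w` plus errors. That cancels one
  -- of the two `w` coming from `hx1` and `hx2`, and no error occurs more than three times.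
  have hmass : -∑ i, |∑ j, X i j + p i - r i| ≤ ∑ i, ∑ j, X i j + ∑ i, p i - ∑ i, r i := by
    rw [← Finset.sum_add_distrib, ← Finset.sum_sub_distrib, ← Finset.sum_neg_distrib]
    exact Finset.sum_le_sum fun i _ => neg_abs_le _
  have k1 : 0 ≤ ∑ j, |∑ i, X i j + q j - c j| := Finset.sum_nonneg fun i _ => abs_nonneg _
  linarith [abs_nonneg (∑ i, p i + w - (∑ i, r i - s)),
    abs_nonneg (∑ j, q j + w - (∑ j, c j - s))]

end Accuracy

/-! Correctness and running time of feasible Sinkhorn. -/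

section FeasibleSinkhorn

theorem le_maxNorm {ι κ : Type} [Finite ι] [Finite κ] (M : Matrix ι κ ℝ) (i : ι) (j : κ) :
    |M i j| ≤ maxNorm M :=
  le_ciSup (f := fun p : ι × κ => |M p.1 p.2|) (Set.finite_range _).bddAbove (i, j)

theorem maxNorm_nonneg {ι κ : Type} (M : Matrix ι κ ℝ) : 0 ≤ maxNorm M :=
  Real.iSup_nonneg fun _ => abs_nonneg _

variable {n : ℕ} {C : Matrix (Fin n) (Fin n) ℝ} {r c : Fin n → ℝ} {s ε A : ℝ}

theorem extendedCost_nonneg (hC : ∀ i j, 0 ≤ C i j) (hA : 0 ≤ A) (i j : Fin n ⊕ Unit) :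
    0 ≤ extendedCost C A i j := by
  rcases i with i | i <;> rcases j with j | j <;> simp [extendedCost, hC, hA]

theorem extendedCost_le (hC : maxNorm C ≤ A) (i j : Fin n ⊕ Unit) : extendedCost C A i j ≤ A := by
  have hA : 0 ≤ A := (maxNorm_nonneg C).trans hC
  rcases i with i | i <;> rcases j with j | j <;> simp [extendedCost, hA]
  exact (le_abs_self _).trans ((le_maxNorm C i j).trans hC)

theorem maxNorm_extendedCost (hC0 : ∀ i j, 0 ≤ C i j) (hC : maxNorm C ≤ A) :
    maxNorm (extendedCost C A) = A := by
  have hA : 0 ≤ A := (maxNorm_nonneg C).trans hC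
  refine le_antisymm (ciSup_le fun p => ?_) ?_
  · rw [abs_of_nonneg (extendedCost_nonneg hC0 hA _ _)]
    exact extendedCost_le hC _ _
  · refine le_trans ?_ (le_maxNorm _ (Sum.inr ()) (Sum.inr ()))
    simpa [extendedCost] using le_abs_self A

/-- The extension of a feasible plan to the dummy points, divided by `D`. -/
noncomputable def extendedPlan (Y : Matrix (Fin n) (Fin n) ℝ) (r c : Fin n → ℝ) (D : ℝ) :
    Matrix (Fin n ⊕ Unit) (Fin n ⊕ Unit) ℝ :=
  Matrix.of fun i j => Sum.elim
    (fun i => Sum.elim (fun j => Y i j / D) (fun _ => (r i - ∑ j, Y i j) / D) j)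
    (fun _ => Sum.elim (fun j => (c j - ∑ i, Y i j) / D) (fun _ => 0) j) i

/-- If the scaled Sinkhorn plan meets the stopping criterion, then rounding its blocks gives an
approximate solution. -/
theorem isApproxSolution_roundPOT (hn : 0 < n) (hC0 : ∀ i j, 0 ≤ C i j) (hr : ∀ i, 0 ≤ r i)
    (hc : ∀ j, 0 ≤ c j) (hs : 0 ≤ s) (hsr : s ≤ ∑ i, r i) (hsc : s ≤ ∑ j, c j) (hε : 0 < ε)
    (hA : 0 < A) (hCA : 2 * maxNorm C ≤ A) {D δ : ℝ} (hD : D = ∑ i, r i + (∑ j, c j - s))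
    (hD0 : 0 < D) (hδ : δ = min 1 (ε / D / (8 * A)))
    {B : Matrix (Fin n ⊕ Unit) (Fin n ⊕ Unit) ℝ} {u v : Fin n ⊕ Unit → ℝ}
    (hB : B = gibbsPlan (Matrix.of fun i j => extendedCost C A i j /
      (ε / D / (4 * Real.log (Fintype.card (Fin n ⊕ Unit))))) u v)
    (herr : marginalError B
      (smooth (fun i => extendedMarginal r (∑ j, c j - s) i / D) δ).val
      (smooth (fun j => extendedMarginal c (∑ i, r i - s) j / D) δ).val ≤ δ / 2) :
    IsApproxSolution C r c s ε
      (roundPOT (Matrix.of fun i j => D * B (Sum.inl i) (Sum.inl j))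
        (fun i => D * B (Sum.inl i) (Sum.inr ())) (fun j => D * B (Sum.inr ()) (Sum.inl j))
        r c s).val := by
  have : Nonempty (Fin n) := ⟨⟨0, hn⟩⟩
  have : Nontrivial (Fin n ⊕ Unit) := ⟨Sum.inl ⟨0, hn⟩, Sum.inr (), by simp⟩
  have hm0 := maxNorm_nonneg C
  have hB0 : ∀ i j, 0 ≤ B i j := fun i j => hB ▸ (gibbsPlan_pos _ u v i j).le
  obtain ⟨h1, h2⟩ := sinkhorn_accuracy (extendedCost_nonneg hC0 hA.le)
    (extendedCost_le (by linarith)) hA (div_pos hε hD0)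
    (a := fun i => extendedMarginal r (∑ j, c j - s) i / D)
    (b := fun j => extendedMarginal c (∑ i, r i - s) j / D)
    (fun i => div_nonneg (by
      rcases i with i | i
      · exact hr i
      · exact sub_nonneg.2 hsc) hD0.le)
    (fun j => div_nonneg (by
      rcases j with j | j
      · exact hc j
      · exact sub_nonneg.2 hsr) hD0.le)
    (by
      rw [← Finset.sum_div, div_eq_one_iff_eq hD0.ne', Fintype.sum_sum_type]
      simp [extendedMarginal, hD])
    (by
      rw [← Finset.sum_div, div_eq_one_iff_eq hD0.ne', Fintype.sum_sum_type]
      simp [extendedMarginal, hD]; ring)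
    hδ hB herr
  have hscale : ∀ x y : ℝ, |D * x - y| = D * |x - y / D| := fun x y => by
    rw [← abs_of_pos hD0, ← abs_mul, abs_of_pos hD0, mul_sub, mul_div_cancel₀ _ hD0.ne']
  obtain ⟨h3, h4⟩ := roundPOT_spec (C := C)
    (X := Matrix.of fun i j => D * B (Sum.inl i) (Sum.inl j))
    (p := fun i => D * B (Sum.inl i) (Sum.inr ())) (q := fun j => D * B (Sum.inr ()) (Sum.inl j))
    (w := D * B (Sum.inr ()) (Sum.inr ())) (η := D * δ) (m := maxNorm C) hn hC0
    (fun i j => (le_abs_self _).trans (le_maxNorm C i j)) hm0 hr hc hs hsr hsc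
    (fun i j => mul_nonneg hD0.le (hB0 _ _)) (fun i => mul_nonneg hD0.le (hB0 _ _))
    (fun j => mul_nonneg hD0.le (hB0 _ _)) (mul_nonneg hD0.le (hB0 _ _))
    (by
      refine le_trans (le_of_eq ?_) (mul_le_mul_of_nonneg_left h1 hD0.le)
      simp only [marginalError, Fintype.sum_sum_type, Matrix.of_apply, ← Finset.mul_sum, ← mul_add,
        hscale, extendedMarginal, Sum.elim_inl, Sum.elim_inr, Finset.univ_unique,
        Finset.sum_singleton])
  refine ⟨h3, fun Y hY => h4.trans ?_⟩
  obtain ⟨hY0, hYr, hYc, hYs⟩ := hY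
  -- The comparison plan has corner zero, so the dummy cost `A` does not enter the right-hand side.
  have h5 := h2 (extendedPlan Y r c D)
    (by
      rintro (i | i) (j | j)
      · exact div_nonneg (hY0 i j) hD0.le
      · exact div_nonneg (sub_nonneg.2 (hYr i)) hD0.le
      · exact div_nonneg (sub_nonneg.2 (hYc j)) hD0.le
      · exact le_rfl)
    (by
      rintro (i | i)
      · simp only [Fintype.sum_sum_type, extendedPlan, extendedMarginal, Matrix.of_apply,
          Sum.elim_inl, Sum.elim_inr, Finset.univ_unique, Finset.sum_singleton, ← Finset.sum_div]
        ring
      · simp only [Fintype.sum_sum_type, extendedPlan, extendedMarginal, Matrix.of_apply,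
          Sum.elim_inl, Sum.elim_inr, Finset.univ_unique, Finset.sum_singleton, ← Finset.sum_div,
          Finset.sum_sub_distrib]
        rw [← sum_sum_comm, hYs, add_zero])
    (by
      rintro (i | i)
      · simp only [Fintype.sum_sum_type, extendedPlan, extendedMarginal, Matrix.of_apply,
          Sum.elim_inl, Sum.elim_inr, Finset.univ_unique, Finset.sum_singleton, ← Finset.sum_div]
        ring
      · simp only [Fintype.sum_sum_type, extendedPlan, extendedMarginal, Matrix.of_apply,
          Sum.elim_inl, Sum.elim_inr, Finset.univ_unique, Finset.sum_singleton, ← Finset.sum_div,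
          Finset.sum_sub_distrib]
        rw [hYs, add_zero])
  have h6 : ∀ Z : Matrix (Fin n ⊕ Unit) (Fin n ⊕ Unit) ℝ,
      D * ∑ i, ∑ j, extendedCost C A i j * Z i j =
        ∑ i, ∑ j, C i j * (D * Z (Sum.inl i) (Sum.inl j)) +
          A * (D * Z (Sum.inr ()) (Sum.inr ())) := by
    intro Z
    simp only [Fintype.sum_sum_type, extendedCost, Finset.univ_unique, Finset.sum_singleton,
      Matrix.fromBlocks_apply₁₁, Matrix.fromBlocks_apply₁₂, Matrix.fromBlocks_apply₂₁,
      Matrix.fromBlocks_apply₂₂, Matrix.zero_apply, zero_mul, Finset.sum_const_zero, add_zero,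
      zero_add, Matrix.of_apply, mul_add, Finset.mul_sum]
    congr 1
    · exact Finset.sum_congr rfl fun i _ => Finset.sum_congr rfl fun j _ => by ring
    · simp only [PUnit.default_eq_unit]; ring
  have h7 := h6 B
  have h8 := h6 (extendedPlan Y r c D)
  have h9 : ∑ i, ∑ j, C i j * (D * extendedPlan Y r c D (Sum.inl i) (Sum.inl j)) = cost C Y := by
    refine Finset.sum_congr rfl fun i _ => Finset.sum_congr rfl fun j _ => ?_
    simp only [extendedPlan, Matrix.of_apply, Sum.elim_inl]
    rw [mul_div_cancel₀ _ hD0.ne']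
  have h10 : extendedPlan Y r c D (Sum.inr ()) (Sum.inr ()) = 0 := rfl
  rw [h9, h10, mul_zero, mul_zero, add_zero] at h8
  have h11 : D * ∑ i, ∑ j, extendedCost C A i j * B i j ≤ cost C Y + 11 / 16 * ε := by
    refine (mul_le_mul_of_nonneg_left h5 hD0.le).trans_eq ?_
    rw [mul_add, h8]
    field_simp
  -- The factor `2` in `hCA` is used here: three such terms together with `11 / 16 * ε` stay below
  -- `ε`.
  have h12 : maxNorm C * (D * δ) ≤ ε / 16 := by
    have : D * δ ≤ ε / (8 * A) := by
      calc D * δ ≤ D * (ε / D / (8 * A)) := by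
            gcongr; exact hδ ▸ min_le_right _ _
        _ = ε / (8 * A) := by field_simp
    calc maxNorm C * (D * δ) ≤ A / 2 * (ε / (8 * A)) :=
          mul_le_mul (by linarith) this (mul_nonneg hD0.le
            (hδ ▸ le_min zero_le_one (by positivity))) (by positivity)
      _ = ε / 16 := by field_simp; norm_num
  -- Rounding away the corner costs no more than the extended objective already charges for it.
  have h13 : maxNorm C * (D * B (Sum.inr ()) (Sum.inr ())) ≤
      A * (D * B (Sum.inr ()) (Sum.inr ())) :=
    mul_le_mul_of_nonneg_right (by linarith) (mul_nonneg hD0.le (hB0 _ _))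
  have h14 : cost C (Matrix.of fun i j => D * B (Sum.inl i) (Sum.inl j)) =
      ∑ i, ∑ j, C i j * (D * B (Sum.inl i) (Sum.inl j)) := rfl
  rw [h14]
  linarith

theorem feasibleSinkhorn_val_of_sinkhorn (hr : ∀ i, 0 ≤ r i) (hc : ∀ j, 0 ≤ c j) {D : ℝ}
    (hD : D = ∑ i, r i + (∑ j, c j - s)) {cap : ℕ}
    {B : Matrix (Fin n ⊕ Unit) (Fin n ⊕ Unit) ℝ}
    (hB : (sinkhorn (extendedCost C A) (fun i => extendedMarginal r (∑ j, c j - s) i / D)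
      (fun j => extendedMarginal c (∑ i, r i - s) j / D) (ε / D) cap).val = some B) :
    (feasibleSinkhorn C r c s ε A cap).val = some
      (roundPOT (Matrix.of fun i j => D * B (Sum.inl i) (Sum.inl j))
        (fun i => D * B (Sum.inl i) (Sum.inr ())) (fun j => D * B (Sum.inr ()) (Sum.inl j))
        r c s).val ∧
    (feasibleSinkhorn C r c s ε A cap).ops ≤
      18 * n ^ 2 + 68 * n + 54 + cap * (6 * (n + 1) ^ 2 + 15 * (n + 1) + 2) := by
  have hR : ∑ i, |r i| = ∑ i, r i := Finset.sum_congr rfl fun i _ => abs_of_nonneg (hr i)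
  have hS : ∑ j, |c j| = ∑ j, c j := Finset.sum_congr rfl fun j _ => abs_of_nonneg (hc j)
  have hext : (Matrix.of fun i j => extendedCost C A i j) = extendedCost C A := rfl
  constructor
  · simp only [feasibleSinkhorn, Timed.bind_val, normOneOp, subOp, addOp, divOp, tabulate,
      tabulateMatrix, Timed.pure_val, hR, hS, ← hD, hext, hB]
    rfl
  · simp only [feasibleSinkhorn, Timed.bind_ops, normOneOp, subOp, addOp, divOp,
      tabulate, tabulateMatrix, Timed.pure_val, Timed.pure_ops, hR, hS, ← hD, hext, hB, mulOp,
      Finset.sum_const, Finset.card_univ, smul_eq_mul, Fintype.card_sum, Fintype.card_fin,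
      Fintype.card_unit]
    have h1 := sinkhorn_ops_le (extendedCost C A)
      (fun i => extendedMarginal r (∑ j, c j - s) i / D)
      (fun j => extendedMarginal c (∑ i, r i - s) j / D) (ε / D) cap
    have h2 := roundPOT_ops_le (Matrix.of fun i j => D * B (Sum.inl i) (Sum.inl j))
        (fun i => D * B (Sum.inl i) (Sum.inr ())) (fun j => D * B (Sum.inr ()) (Sum.inl j)) r c s
    simp only [Fintype.card_sum, Fintype.card_fin, Fintype.card_unit] at h1
    linarith only [h1, h2]

/-- Feasible Sinkhorn terminates with an approximate solution; the number of operations is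
quadratic in `n` times the number of iterations, which is bounded by the range of the scaled costs
over the accuracy of the marginals. -/
theorem feasibleSinkhorn_spec (hn : 0 < n) (hC0 : ∀ i j, 0 ≤ C i j) (hr : ∀ i, 0 ≤ r i)
    (hc : ∀ j, 0 ≤ c j) (hs : 0 ≤ s) (hsr : s ≤ ∑ i, r i) (hsc : s ≤ ∑ j, c j) (hε : 0 < ε)
    (hA : 0 < A) (hCA : 2 * maxNorm C ≤ A) {D δ : ℝ} (hD : D = ∑ i, r i + (∑ j, c j - s))
    (hD0 : 0 < D) (hδ : δ = min 1 (ε / D / (8 * A))) :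
    ∃ cap X, (feasibleSinkhorn C r c s ε A cap).val = some X ∧ IsApproxSolution C r c s ε X ∧
      ((feasibleSinkhorn C r c s ε A cap).ops : ℝ) ≤ (n : ℝ) ^ 2 * (308 + 1792 *
        ((4 * (A * D / ε) * Real.log (n + 1) - Real.log (δ / 8 / (n + 1))) / δ)) := by
  have : Nonempty (Fin n) := ⟨⟨0, hn⟩⟩
  have hcard : (Fintype.card (Fin n ⊕ Unit) : ℝ) = n + 1 := by simp
  have hl : 0 < Real.log (n + 1) :=
    Real.log_pos (by have : (0 : ℝ) < n := Nat.cast_pos.2 hn; linarith)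
  have hδ0 : 0 < δ := hδ ▸ lt_min one_pos (by positivity)
  have hδ1 : δ ≤ 1 := hδ ▸ min_le_left _ _
  set a := fun i => extendedMarginal r (∑ j, c j - s) i / D with ha_def
  set b := fun j => extendedMarginal c (∑ i, r i - s) j / D with hb_def
  have ha : ∀ i, 0 ≤ a i := fun i => div_nonneg (by
      rcases i with i | i
      · exact hr i
      · exact sub_nonneg.2 hsc) hD0.le
  have hb : ∀ j, 0 ≤ b j := fun j => div_nonneg (by
      rcases j with j | j
      · exact hc j
      · exact sub_nonneg.2 hsr) hD0.le
  have ha1 : ∑ i, a i = 1 := by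
    rw [ha_def, ← Finset.sum_div, div_eq_one_iff_eq hD0.ne', Fintype.sum_sum_type]
    simp [extendedMarginal, hD]
  have hb1 : ∑ j, b j = 1 := by
    rw [hb_def, ← Finset.sum_div, div_eq_one_iff_eq hD0.ne', Fintype.sum_sum_type]
    simp [extendedMarginal, hD]; ring
  set γ := ε / D / (4 * Real.log (n + 1)) with hγ
  have hγ0 : 0 < γ := by positivity
  set G : Matrix (Fin n ⊕ Unit) (Fin n ⊕ Unit) ℝ :=
    Matrix.of fun i j => extendedCost C A i j / γ with hG
  set α := δ / 8 / ((n : ℝ) + 1) with hα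
  have hα0 : 0 < α := by positivity
  have hα1 : α < 1 := by
    rw [hα, div_lt_one (by positivity)]
    have : (0 : ℝ) ≤ n := by positivity
    linarith
  have hlα : Real.log α < 0 := Real.log_neg hα0 hα1
  have hg : A / γ = 4 * (A * D / ε) * Real.log (n + 1) := by
    rw [hγ]; field_simp
  have hρ0 : 0 < A / γ - Real.log α := by
    have : 0 < A / γ := by positivity
    linarith
  set h := ⌊8 * (A / γ - Real.log α) / (δ / 2)⌋₊ + 1 with hh
  have hh1 : 8 * (A / γ - Real.log α) < h * (δ / 2) := by
    rw [← div_lt_iff₀ (by positivity), hh]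
    push_cast
    exact Nat.lt_floor_add_one _
  have hh2 : (h : ℝ) ≤ 16 * ((A / γ - Real.log α) / δ) + 1 := by
    rw [hh]
    push_cast
    have := Nat.floor_le (a := 8 * (A / γ - Real.log α) / (δ / 2)) (by positivity)
    have e : 8 * (A / γ - Real.log α) / (δ / 2) = 16 * ((A / γ - Real.log α) / δ) := by
      field_simp; ring
    linarith
  obtain ⟨k, hk, hkerr⟩ := exists_marginalError_le (G := G) (a := (smooth a δ).val)
    (b := (smooth b δ).val) (g := A / γ) (α := α) (tol := δ / 2)
    (fun i j => div_nonneg (extendedCost_nonneg hC0 hA.le i j) hγ0.le)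
    (fun i j => div_le_div_of_nonneg_right
      (extendedCost_le (by linarith [maxNorm_nonneg C]) i j) hγ0.le) hα0
    (fun i => by have := le_smooth ha hδ1 i; rwa [hcard] at this)
    (fun i => by have := le_smooth hb hδ1 i; rwa [hcard] at this)
    (sum_smooth ha1 δ) (sum_smooth hb1 δ) (by positivity) hρ0 hh1
  obtain ⟨u, v, hval, herr⟩ := sinkhornLoop_spec G _ _ _ k (2 * h + 1) (true, 0, 0) (by omega) hkerr
  have hsink : (sinkhorn (extendedCost C A) a b (ε / D) (2 * h + 1)).val =
      some (gibbsPlan G u v) := by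
    rw [sinkhorn_val, maxNorm_extendedCost hC0 (by linarith [maxNorm_nonneg C]), ← hδ, hcard]
    exact hval
  obtain ⟨e1, e2⟩ := feasibleSinkhorn_val_of_sinkhorn hr hc hD hsink
  refine ⟨2 * h + 1, _, e1, isApproxSolution_roundPOT hn hC0 hr hc hs hsr hsc hε hA hCA hD hD0 hδ
    (u := u) (v := v) (by rw [hcard]) herr, ?_⟩
  have e3 : ((feasibleSinkhorn C r c s ε A (2 * h + 1)).ops : ℝ) ≤
      18 * n ^ 2 + 68 * n + 54 + (2 * h + 1) * (6 * (n + 1) ^ 2 + 15 * (n + 1) + 2) := by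
    exact_mod_cast e2
  have hn1 : (1 : ℝ) ≤ n := by exact_mod_cast hn
  have hn2 : (n : ℝ) ≤ n ^ 2 := le_self_pow₀ hn1 two_ne_zero
  have h56 : 6 * ((n : ℝ) + 1) ^ 2 + 15 * (n + 1) + 2 ≤ 56 * n ^ 2 := by
    linarith only [hn1, hn2]
  rw [← hg]
  calc _ ≤ _ := e3
    _ ≤ 140 * (n : ℝ) ^ 2 + (2 * (16 * ((A / γ - Real.log α) / δ) + 1) + 1) * (56 * n ^ 2) := by
      refine add_le_add (by linarith only [hn1, hn2])
        (mul_le_mul (by linarith only [hh2]) h56 (by positivity) ?_)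
      have := div_pos hρ0 hδ0
      linarith only [this]
    _ = _ := by ring

/-- The operation count of `feasibleSinkhorn_spec` in terms of the cost and the accuracy. -/
theorem iteration_bound {x l H Q N δ : ℝ} (hx : 0 < x) (hN : 2 ≤ N) (hl : l = Real.log N)
    (hH : 0 ≤ H) (hQ : 1 ≤ Q) (hxQ : x ≤ H * Q) (hδ : δ = min 1 (1 / (8 * x))) :
    308 + 1792 * ((4 * x * l - Real.log (δ / 8 / N)) / δ) ≤
      (616 + 1792 * ((6 + 20 * H) * (1 + 8 * H))) * (Q ^ 2 * l) := by
  have hlog2 : (1 : ℝ) / 2 ≤ Real.log 2 := by linarith [Real.log_two_gt_d9]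
  have hl2 : Real.log 2 ≤ l := hl ▸ Real.log_le_log (by norm_num) hN
  have hδ0 : 0 < δ := hδ ▸ lt_min one_pos (by positivity)
  -- The cap of `δ` at `1` contributes the summand `1`, absorbed by `Q ≥ 1`.
  have hδinv : 1 / δ ≤ (1 + 8 * H) * Q := by
    have : 1 / δ ≤ 1 + 8 * x := by
      rw [hδ]
      rcases min_choice 1 (1 / (8 * x)) with h | h
      · rw [h]; linarith
      · rw [h, one_div_one_div]; linarith
    nlinarith
  have e1 : Real.log (δ / 8 / N) = -Real.log (1 / δ) - 3 * Real.log 2 - l := by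
    have h8 : Real.log 8 = 3 * Real.log 2 := by
      rw [show (8 : ℝ) = 2 ^ 3 by norm_num, Real.log_pow]; norm_num
    rw [Real.log_div (by positivity) (by positivity), Real.log_div hδ0.ne' (by norm_num), h8,
      one_div, Real.log_inv, hl]
    ring
  -- The crude bound `log y ≤ y - 1` suffices, since `4 * x * l` is already allowed to be of order
  -- `Q * l`; the factor `2` comes from `l ≥ 1 / 2`. No further logarithm of the accuracy appears.
  have e2 : Real.log (1 / δ) ≤ 2 * (1 + 8 * H) * Q * l := by
    have h1 := Real.log_le_sub_one_of_pos (one_div_pos.2 hδ0)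
    have h2 : 0 ≤ (1 + 8 * H) * Q := by positivity
    nlinarith
  have hQl : l ≤ Q * l := le_mul_of_one_le_left (by linarith) hQ
  have e3 : 4 * x * l - Real.log (δ / 8 / N) ≤ (6 + 20 * H) * (Q * l) := by
    have : x * l ≤ H * Q * l := mul_le_mul_of_nonneg_right hxQ (by linarith)
    rw [e1]
    linarith
  have e4 : (4 * x * l - Real.log (δ / 8 / N)) / δ ≤
      ((6 + 20 * H) * (Q * l)) * ((1 + 8 * H) * Q) := by
    rw [div_eq_mul_one_div]
    refine mul_le_mul e3 hδinv (one_div_pos.2 hδ0).le ?_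
    have : 0 ≤ l := by linarith
    positivity
  have e5 : 1 / 2 ≤ Q ^ 2 * l := by
    have : 1 ≤ Q ^ 2 := one_le_pow₀ hQ
    nlinarith
  calc _ ≤ 616 * (Q ^ 2 * l) +
        1792 * (((6 + 20 * H) * (Q * l)) * ((1 + 8 * H) * Q)) := by linarith
    _ = _ := by ring

end FeasibleSinkhorn

end POT

/-! ### The complexity theorem. -/

theorem mainTheorem5 :
    ∃ K : ℝ, 0 < K ∧ ∀ L W : ℝ, ∃ M : ℝ, 0 < M ∧
      ∀ (n : ℕ) (C : Matrix (Fin n) (Fin n) ℝ) (r c : Fin n → ℝ) (s ε A : ℝ),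
        (∀ i j, 0 ≤ C i j) → (∀ i, 0 ≤ r i) → (∀ j, 0 ≤ c j) →
        0 < ∑ i, r i + ∑ j, c j →
        0 ≤ s → s ≤ ∑ i, r i → s ≤ ∑ j, c j →
        0 < ε → ε ≤ 1 →
        POT.maxNorm C < A → K * POT.maxNorm C / ε ≤ A →
        ∃ (cap : ℕ) (X : Matrix (Fin n) (Fin n) ℝ) (T : ℕ),
          POT.feasibleSinkhorn C r c s ε A cap = ⟨some X, T⟩ ∧
          POT.IsApproxSolution C r c s ε X ∧
          (∑ i, r i ≤ W → ∑ j, c j ≤ W → A ≤ L * POT.maxNorm C / ε → ε ^ 2 ≤ POT.maxNorm C →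
            (T : ℝ) ≤ M * ((n : ℝ) ^ 2 * POT.maxNorm C ^ 2 / ε ^ 4) * Real.log (n + 1)) := by
  -- As `ε ≤ 1`, the choice `K = 2` yields `2‖C‖ ≤ A`. The constant `H` is the one in `A D / ε ≤ H
  -- ‖C‖ / ε²`, using `D ≤ 2|W|`.
  refine ⟨2, two_pos, fun L W => ?_⟩
  set H := 2 * |L| * |W| with hH
  refine ⟨616 + 1792 * ((6 + 20 * H) * (1 + 8 * H)), by positivity, ?_⟩
  intro n C r c s ε A hC hr hc hrc hs hsr hsc hε hε1 hCA hKA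
  have hm0 := POT.maxNorm_nonneg C
  have hA : 0 < A := hm0.trans_lt hCA
  have hn : 0 < n := by
    rcases Nat.eq_zero_or_pos n with rfl | h
    · simp at hrc
    · exact h
  have hCA2 : 2 * POT.maxNorm C ≤ A :=
    (le_div_self (by positivity) hε hε1).trans hKA
  -- If `r` has no mass then `s = 0`, and `D` is the mass of `c`, which is positive.
  have hD0 : 0 < ∑ i, r i + (∑ j, c j - s) := by
    rcases (hs.trans hsr).eq_or_lt with h | h <;> linarith
  set D := ∑ i, r i + (∑ j, c j - s) with hD
  obtain ⟨cap, X, h1, h2, h3⟩ := POT.feasibleSinkhorn_spec hn hC hr hc hs hsr hsc hε hA hCA2 hD hD0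
    rfl
  refine ⟨cap, X, (POT.feasibleSinkhorn C r c s ε A cap).ops, by rw [← h1], h2, ?_⟩
  intro hrW hcW hAL hεm
  have hDW : D ≤ 2 * |W| := by linarith [le_abs_self W]
  have hxQ : A * D / ε ≤ H * (POT.maxNorm C / ε ^ 2) := by
    calc A * D / ε ≤ (|L| * POT.maxNorm C / ε) * (2 * |W|) / ε := by
          gcongr
          exact hAL.trans (by gcongr; exact le_abs_self L)
      _ = _ := by rw [hH]; field_simp
  have hb := POT.iteration_bound (x := A * D / ε) (N := n + 1) (H := H)
    (Q := POT.maxNorm C / ε ^ 2) (δ := min 1 (ε / D / (8 * A))) (by positivity)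
    (by have : (1 : ℝ) ≤ n := by exact_mod_cast hn
        linarith) rfl (by positivity) ((one_le_div (by positivity)).2 hεm) hxQ
    (by congr 1; field_simp)
  refine (h3.trans (mul_le_mul_of_nonneg_left hb (by positivity))).trans_eq ?_
  field_simp
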